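/- For an integer $n\ge 2$ let $\Lambda_n=\{1,\dots,n-1\}$ and $\Omega_n=\{0,1\}^{\Lambda_n}$. For $\eta\in\Omega_n$ let $\eta^{x,y}$ be $\eta$ with the values at $x$ and $y$ exchanged, and let $\eta^x$ be $\eta$ with the value at $x$ replaced by $1-\eta(x)$. For $\rho\in(0,1)$, the symmetric simple exclusion process with reservoirs of density $\rho$ is the continuous-time Markov chain $(\eta_t)_{t\ge0}$ on $\Omega_n$ with generator $$\mathfrak L_nf(\eta)=n^2\sum_{x=1}^{n-2}\big(f(\eta^{x,x+1})-f(\eta)\big)+n^2\sum_{x\in\{1,n-1\}}\big(\rho(1-\eta(x))+(1-\rho)\eta(x)\big)\big(f(\eta^x)-f(\eta)\big).$$ For $u:\Lambda_n\to[0,1]$ let $\nu^n_{u}$ be the Bernoulli product measure on $\Omega_n$ with density $u$, that is, $\nu^n_u(\eta)=\prod_{x\in\Lambda_n}\{\eta(x)u(x)+(1-\eta(x))(1-u(x))\}$. For $0<\varepsilon_0\le\min\{\rho,1-\rho\}$ and $\kappa\ge0$ let $\mathcal U_{\varepsilon_0,\kappa}$ (which depends also on $\rho$) be the set of differentiable functions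 $u:[0,1]\to[0,1]$ with $\varepsilon_0\le u\le1-\varepsilon_0$, $u(0)=u(1)=\rho$ and $|u'|\le\kappa$ on $[0,1]$. Given $u_0\in\mathcal U_{\varepsilon_0,\kappa}$, start the process from the Bernoulli product measure with density $x\mapsto u_0(x/n)$. Let $\mu^n_t$ be the law of $\eta_t$, let $u^n_t(x)=\mathbb E[\eta_t(x)]$ for $x\in\Lambda_n$ and $u^n_t(0)=u^n_t(n)=\rho$, let $\nu^n_t=\nu^n_{u^n_t}$, and let $H_n(t)=\int f^n_t\log f^n_t\,d\nu^n_t$ with $f^n_t=d\mu^n_t/d\nu^n_t$ be the relative entropy of $\mu^n_t$ with respect to $\nu^n_t$. Theorem. For every $\varepsilon_0>0$ and $\kappa\ge0$ there are constants $C_0=C_0(\varepsilon_0,\kappa)>0$ and $\delta_0=\delta_0(\varepsilon_0,\kappa)>0$ such that, for every $\rho$ with $\varepsilon_0\le\min\{\rho,1-\rho\}$, every $u_0\in\mathcal U_{\varepsilon_0,\kappa}$ and every $n\ge2$, $$H_n(t)\le C_0e^{-\delta_0t}\qquad\text{for all }t\ge0 .$$ Moreover, for $n\ge3$ the densities $u^n_t$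 solve the discrete heat equation $\frac{d}{dt}u^n_t(x)=n^2\big(u^n_t(x+1)+u^n_t(x-1)-2u^n_t(x)\big)$ for $x\in\Lambda_n$ and $t\ge0$, with $u^n_t(0)=u^n_t(n)=\rho$ and $u^n_0(x)=u_0(x/n)$ for $x\in\Lambda_n$. -/

import Mathlib

open MeasureTheory ProbabilityTheory Filter Topology Set
open scoped NNReal ENNReal

noncomputable section

namespace SSEP

/-- The bulk `Λ_n = {1, …, n-1}`. -/
abbrev Site (n : ℕ) : Type := {x : ℕ // x ∈ Finset.Ioo 0 n}

/-- Configurations `Ω_n = {0,1}^{Λ_n}`; `true` means "occupied". -/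
abbrev Config (n : ℕ) : Type := Site n → Bool

/-- The occupation number, `0` or `1`, as a real number. -/
def occ (b : Bool) : ℝ := if b then 1 else 0

/-- `η^{x,y}`: the contents of the sites `x` and `y` are exchanged. -/
def exchange {n : ℕ} (x y : Site n) (η : Config n) : Config n :=
  fun z => η (Equiv.swap x y z)

/-- `η^x`: the content of the site `x` is flipped. -/
def flip {n : ℕ} (x : Site n) (η : Config n) : Config n :=
  Function.update η x (!η x)

/-- The generator of the symmetric simple exclusion process on `{1, …, n-1}` with reservoirs of
density `ρ`, in diffusive time scale. The second sum runs over the set `{1, n-1}`. -/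
def generator (n : ℕ) (ρ : ℝ) : (Config n → ℝ) →ₗ[ℝ] (Config n → ℝ) where
  toFun f η :=
    (n : ℝ) ^ 2 * ∑ x : Site n, ∑ y : Site n,
        (if y.1 = x.1 + 1 then f (exchange x y η) - f η else 0)
      + (n : ℝ) ^ 2 * ∑ x : Site n,
        (if x.1 = 1 ∨ x.1 + 1 = n then
          (ρ * (1 - occ (η x)) + (1 - ρ) * occ (η x)) * (f (flip x η) - f η) else 0)
  map_add' f g := by
    funext η
    have h₁ : ∀ x y : Site n,
        (if y.1 = x.1 + 1 then (f + g) (exchange x y η) - (f + g) η else 0)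
          = (if y.1 = x.1 + 1 then f (exchange x y η) - f η else 0)
            + (if y.1 = x.1 + 1 then g (exchange x y η) - g η else 0) := by
      intro x y
      simp only [Pi.add_apply]
      split_ifs <;> ring
    have h₂ : ∀ x : Site n,
        (if x.1 = 1 ∨ x.1 + 1 = n then
          (ρ * (1 - occ (η x)) + (1 - ρ) * occ (η x)) * ((f + g) (flip x η) - (f + g) η) else 0)
          = (if x.1 = 1 ∨ x.1 + 1 = n then
              (ρ * (1 - occ (η x)) + (1 - ρ) * occ (η x)) * (f (flip x η) - f η) else 0)
            + (if x.1 = 1 ∨ x.1 + 1 = n then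
              (ρ * (1 - occ (η x)) + (1 - ρ) * occ (η x)) * (g (flip x η) - g η) else 0) := by
      intro x
      simp only [Pi.add_apply]
      split_ifs <;> ring
    simp only [h₁, h₂, Finset.sum_add_distrib]
    simp only [Pi.add_apply]
    ring
  map_smul' c f := by
    funext η
    simp only [Pi.smul_apply, smul_eq_mul, RingHom.id_apply, Finset.mul_sum, mul_add]
    congr 1
    · refine Finset.sum_congr rfl fun x _ => Finset.sum_congr rfl fun y _ => ?_
      split_ifs <;> ring
    · refine Finset.sum_congr rfl fun x _ => ?_
      split_ifs <;> ring

/-- The Markov semigroup `exp (t L_n)` acting on functions on `Ω_n`. -/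
def semigroup (n : ℕ) (ρ : ℝ) (t : ℝ≥0) : (Config n → ℝ) →L[ℝ] (Config n → ℝ) :=
  NormedSpace.exp ((t : ℝ) • LinearMap.toContinuousLinearMap (generator n ρ))

/-- The Bernoulli product measure on `Ω_n` with density `u`, for `u` with values in `[0,1]`. -/
def bernoulliProduct {n : ℕ} (u : Site n → ℝ) : Measure (Config n) :=
  ∑ η : Config n,
    ENNReal.ofReal (∏ x : Site n, (occ (η x) * u x + (1 - occ (η x)) * (1 - u x))) •
      Measure.dirac η

/-- The class of profiles `U_{ε,κ}` (for the reservoir density `ρ`): differentiable functions on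
`[0,1]` with values in `[ε, 1-ε]`, boundary values `ρ` and derivative bounded by `κ`. -/
structure IsProfile (ρ ε κ : ℝ) (u : ℝ → ℝ) : Prop where
  differentiableOn : DifferentiableOn ℝ u (Icc 0 1)
  mem_Icc : ∀ x ∈ Icc (0 : ℝ) 1, u x ∈ Icc ε (1 - ε)
  left : u 0 = ρ
  right : u 1 = ρ
  abs_deriv_le : ∀ x ∈ Icc (0 : ℝ) 1, |derivWithin u (Icc 0 1) x| ≤ κ

/-- The σ-algebra generated by the process up to time `s`. -/
@[reducible] def past {n : ℕ} {Ω : Type*} (η : ℝ≥0 → Ω → Config n) (s : ℝ≥0) : MeasurableSpace Ω :=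
  ⨆ r ∈ Iic s, MeasurableSpace.comap (η r) inferInstance

/-- Under `P`, `η` is the continuous-time Markov chain on `Ω_n` with càdlàg paths, generated by
`generator n ρ`, and with initial law `ν`. -/
structure IsProcess {n : ℕ} {Ω : Type*} [MeasurableSpace Ω] (ρ : ℝ) (ν : Measure (Config n))
    (P : Measure Ω) (η : ℝ≥0 → Ω → Config n) : Prop where
  measurable : ∀ t, Measurable (η t)
  rightContinuous : ∀ ω t, ContinuousWithinAt (fun s => η s ω) (Ici t) t
  leftLimits : ∀ ω t, ∃ l, Tendsto (fun s => η s ω) (𝓝[<] t) (𝓝 l)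
  initial : P.map (η 0) = ν
  markov : ∀ (s t : ℝ≥0) (f : Config n → ℝ),
    P[fun ω => f (η (s + t) ω) | past η s] =ᵐ[P] fun ω => semigroup n ρ t f (η s ω)

/-- The density `u_t^n(x)`: the expectation of `η_t(x)` for `x` in the bulk, and `ρ` at the
points `0` and `n`. -/
def density {n : ℕ} {Ω : Type*} [MeasurableSpace Ω] (ρ : ℝ) (P : Measure Ω)
    (η : ℝ≥0 → Ω → Config n) (t : ℝ≥0) (x : ℕ) : ℝ :=
  if h : x ∈ Finset.Ioo 0 n then ∫ ω, occ (η t ω ⟨x, h⟩) ∂P else ρ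

/-- The discrete Laplacian, at the points `x = 1, …, n-1`. -/
def discreteLaplacian (n : ℕ) (f : ℕ → ℝ) (x : ℕ) : ℝ :=
  (n : ℝ) ^ 2 * (f (x + 1) + f (x - 1) - 2 * f x)

/-- `u` solves the discrete heat equation on `{0, …, n}` with boundary value `ρ` and initial
value `u₀ (x / n)`. -/
structure IsHeatSolution (n : ℕ) (ρ : ℝ) (u₀ : ℝ → ℝ) (u : ℝ≥0 → ℕ → ℝ) : Prop where
  equation : ∀ (t : ℝ≥0), ∀ x ∈ Finset.Ioo 0 n,
    HasDerivWithinAt (fun s : ℝ => u s.toNNReal x) (discreteLaplacian n (u t) x) (Ici 0) t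
  left : ∀ t, u t 0 = ρ
  right : ∀ t, u t n = ρ
  initial : ∀ x ∈ Finset.Ioo 0 n, u 0 x = u₀ (x / n)

end SSEP

end

noncomputable section

namespace SSEP

/-!
The expected densities solve the discrete heat equation, so they stay in `[ε, 1 - ε]`, and a
comparison argument for the reflected heat equation makes their discrete gradient decay like
`e^{-2t} / n`. The two-point correlations solve a heat equation on the triangle `x < y`, with a
source on the diagonal which is minus the squared gradient; by the maximum principle they are
bounded below by `-C / n`.

Differentiating the relative entropy with respect to the product measure of the same densities, all
terms that are linear in the normalized occupation numbers cancel, and what is left is at most minus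
the Dirichlet form of the square root of the density, minus `n ^ 2 (∇u) ^ 2` summed against the
normalized correlations of nearest neighbours; this last contribution is `O(e^{-4t})`. A logarithmic
Sobolev inequality with a constant independent of `n` bounds the entropy by the Dirichlet form:
the entropy tensorizes over the sites, and a flip at a given site is carried to the reservoir at the
boundary through a path of exchanges. Grönwall's inequality concludes.
-/

/-! ### A maximum principle -/

theorem nonneg_of_isMaxOn_Icc_right {f : ℝ → ℝ} {f' τ : ℝ} (hτ : 0 ≤ τ)
    (hf : HasDerivAt f f' τ) (hmax : IsMaxOn f (Icc 0 τ) τ) : 0 ≤ τ * f' := by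
  have hcone : 0 - τ ∈ posTangentConeAt (Icc 0 τ) τ :=
    sub_mem_posTangentConeAt_of_segment_subset
      ((convex_Icc 0 τ).segment_subset (right_mem_Icc.2 hτ) (left_mem_Icc.2 hτ))
  have := hmax.localize.hasFDerivWithinAt_nonpos hf.hasFDerivAt.hasFDerivWithinAt hcone
  simpa using this

-- The penalty `θ * s` makes the derivative strictly negative at a positive space-time maximum.
theorem nonpos_of_deriv_nonpos_at_max {ι : Type*} {S : Finset ι} {w w' : ℝ → ι → ℝ}
    (hd : ∀ t, 0 ≤ t → ∀ i ∈ S, HasDerivAt (fun s => w s i) (w' t i) t)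
    (h0 : ∀ i ∈ S, w 0 i ≤ 0)
    (hmax : ∀ t, 0 ≤ t → ∀ i ∈ S, 0 < w t i → (∀ j ∈ S, w t j ≤ w t i) → w' t i ≤ 0)
    {T : ℝ} (hT : 0 ≤ T) {i : ι} (hi : i ∈ S) : w T i ≤ 0 := by
  suffices h : ∀ θ : ℝ, 0 < θ → w T i ≤ θ * T by
    have hlim : Tendsto (fun θ : ℝ => θ * T) (𝓝[>] 0) (𝓝 0) := by
      simpa using (tendsto_id.mul_const T).mono_left (nhdsWithin_le_nhds (a := (0 : ℝ)))
    exact ge_of_tendsto hlim (eventually_mem_nhdsWithin.mono h)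
  intro θ hθ
  have hcont : ∀ j ∈ S, ContinuousOn (fun s => w s j - θ * s) (Icc 0 T) := fun j hj s hs =>
    ((hd s hs.1 j hj).continuousAt.sub (by fun_prop)).continuousWithinAt
  choose! τ hτ hτmax using fun j hj =>
    isCompact_Icc.exists_isMaxOn ⟨0, left_mem_Icc.2 hT⟩ (hcont j hj)
  obtain ⟨j, hj, hjmax⟩ := S.exists_max_image (fun j => w (τ j) j - θ * τ j) ⟨i, hi⟩
  have hle : ∀ k ∈ S, ∀ s ∈ Icc 0 T, w s k - θ * s ≤ w (τ j) j - θ * τ j :=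
    fun k hk s hs => (hτmax k hk hs).trans (hjmax k hk)
  by_contra! hlt
  have hpos : 0 < w (τ j) j - θ * τ j := by linarith [hle i hi T (right_mem_Icc.2 hT)]
  have hτ0 : 0 < τ j := (hτ j hj).1.lt_of_ne fun h => by
    rw [← h, mul_zero, sub_zero] at hpos
    exact hpos.not_ge (h0 j hj)
  have hw' : w' (τ j) j ≤ 0 := by
    refine hmax (τ j) hτ0.le j hj ?_ fun k hk => ?_
    · linarith [mul_pos hθ hτ0]
    · linarith [hle k hk (τ j) (hτ j hj)]
  have hder : HasDerivAt (fun s => w s j - θ * s) (w' (τ j) j - θ) (τ j) :=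
    ((hd (τ j) hτ0.le j hj).sub ((hasDerivAt_id (τ j)).const_mul θ)).congr_deriv (by ring)
  have := nonneg_of_isMaxOn_Icc_right hτ0.le hder
    fun s hs => hle j hj s ⟨hs.1, hs.2.trans (hτ j hj).2⟩
  linarith [nonneg_of_mul_nonneg_right this hτ0]

/-! ### The reflected discrete heat equation -/

/-- The Laplacian of `{0, …, n - 1}` with reflecting ends, in diffusive scale. Discrete gradients
of solutions of the discrete heat equation with constant boundary values evolve by it. -/
def reflectedLaplacian (n : ℕ) (v : ℕ → ℝ) (k : ℕ) : ℝ :=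
  (n : ℝ) ^ 2 * ((if k + 1 < n then v (k + 1) - v k else 0) +
    (if 0 < k then v (k - 1) - v k else 0))

/-- The concave increasing profile `1 + d (2 n - d) / n ^ 2`, a barrier in the distance `d` of two
points: it lies between `1` and `2`, and its second difference in diffusive scale is `-2`. -/
def oscillationBarrier (n : ℕ) (d : ℝ) : ℝ := 1 + d * (2 * n - d) / (n : ℝ) ^ 2

section oscillationBarrier

variable {n : ℕ} {d : ℝ}

theorem one_le_oscillationBarrier (hd : 0 ≤ d) (hdn : d ≤ n) : 1 ≤ oscillationBarrier n d :=
  le_add_of_nonneg_right (div_nonneg (mul_nonneg hd (by linarith)) (by positivity))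

theorem oscillationBarrier_le_two (n : ℕ) (d : ℝ) : oscillationBarrier n d ≤ 2 := by
  have : d * (2 * n - d) / (n : ℝ) ^ 2 ≤ 1 :=
    div_le_one_of_le₀ (by nlinarith [sq_nonneg ((n : ℝ) - d)]) (by positivity)
  linarith [show oscillationBarrier n d = 1 + d * (2 * n - d) / (n : ℝ) ^ 2 from rfl]

theorem oscillationBarrier_le_add_one (hdn : d + 1 ≤ n) :
    oscillationBarrier n d ≤ oscillationBarrier n (d + 1) := by
  have : d * (2 * n - d) ≤ (d + 1) * (2 * n - (d + 1)) := by linarith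
  unfold oscillationBarrier
  gcongr

theorem sq_mul_oscillationBarrier_add (hn : 0 < n) (d : ℝ) :
    (n : ℝ) ^ 2 * ((oscillationBarrier n (d + 1) - oscillationBarrier n d) +
      (oscillationBarrier n (d - 1) - oscillationBarrier n d)) = -2 := by
  unfold oscillationBarrier
  field_simp
  ring

end oscillationBarrier

-- Moving one of the two points changes their distance by one, or does nothing at a reflecting end.
theorem reflectedLaplacian_sub_le_at_max {n : ℕ} {B : ℝ} (hB : 0 ≤ B) {v : ℕ → ℝ} {k l : ℕ}
    (hkl : k < l) (hl : l < n)
    (hmax : ∀ i j, i ≤ j → j < n → v i - v j - B * oscillationBarrier n ((j : ℝ) - i) ≤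
      v k - v l - B * oscillationBarrier n ((l : ℝ) - k)) :
    reflectedLaplacian n v k - reflectedLaplacian n v l ≤ -4 * B := by
  set d : ℝ := (l : ℝ) - k
  set g := oscillationBarrier n
  have hdn : d + 1 ≤ n := by
    have : (l : ℝ) + 1 ≤ n := by exact_mod_cast hl
    linarith [k.cast_nonneg (α := ℝ)]
  have hmono : 0 ≤ B * (g (d + 1) - g d) :=
    mul_nonneg hB (sub_nonneg.2 (oscillationBarrier_le_add_one hdn))
  have hk_right : v (k + 1) - v k ≤ B * (g (d - 1) - g d) := by
    have := hmax (k + 1) l hkl hl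
    rw [show (l : ℝ) - (k + 1 : ℕ) = d - 1 by push_cast; ring] at this
    linarith
  have hk_left : (if 0 < k then v (k - 1) - v k else 0) ≤ B * (g (d + 1) - g d) := by
    split_ifs with hk
    · have := hmax (k - 1) l (by omega) hl
      rw [show (l : ℝ) - (k - 1 : ℕ) = d + 1 by push_cast [Nat.one_le_of_lt hk]; ring] at this
      linarith
    · exact hmono
  have hl_left : v l - v (l - 1) ≤ B * (g (d - 1) - g d) := by
    have := hmax k (l - 1) (by omega) (by omega)
    rw [show ((l - 1 : ℕ) : ℝ) - k = d - 1 by push_cast [Nat.one_le_of_lt hkl]; ring] at this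
    linarith
  have hl_right : -(if l + 1 < n then v (l + 1) - v l else 0) ≤ B * (g (d + 1) - g d) := by
    split_ifs with hl'
    · have := hmax k (l + 1) (by omega) hl'
      rw [show ((l + 1 : ℕ) : ℝ) - k = d + 1 by push_cast; ring] at this
      linarith
    · simpa using hmono
  unfold reflectedLaplacian
  rw [if_pos (by omega : k + 1 < n), if_pos (by omega : 0 < l), ← mul_sub]
  calc _ ≤ (n : ℝ) ^ 2 * (2 * B * ((g (d + 1) - g d) + (g (d - 1) - g d))) := by
        gcongr
        linarith
    _ = 2 * B * ((n : ℝ) ^ 2 * ((g (d + 1) - g d) + (g (d - 1) - g d))) := by ring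
    _ = -4 * B := by
        rw [sq_mul_oscillationBarrier_add (by omega)]
        ring

section ReflectedHeatEquation

variable {n : ℕ} {A : ℝ} {v : ℝ → ℕ → ℝ}

theorem sub_le_of_hasDerivAt_reflectedLaplacian (hA : 0 ≤ A)
    (hv : ∀ t, 0 ≤ t → ∀ k < n, HasDerivAt (fun s => v s k) (reflectedLaplacian n (v t) k) t)
    (h0 : ∀ k < n, |v 0 k| ≤ A) {t : ℝ} (ht : 0 ≤ t) {k l : ℕ} (hkl : k ≤ l) (hl : l < n) :
    v t k - v t l ≤ 4 * A * Real.exp (-2 * t) := by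
  set S : Finset (ℕ × ℕ) := (Finset.range n ×ˢ Finset.range n).filter fun q => q.1 ≤ q.2 with hS
  have hmem : ∀ q : ℕ × ℕ, q ∈ S ↔ q.1 ≤ q.2 ∧ q.2 < n := fun q => by
    simp only [hS, Finset.mem_filter, Finset.mem_product, Finset.mem_range]
    omega
  have hg1 : ∀ q ∈ S, 1 ≤ oscillationBarrier n ((q.2 : ℝ) - q.1) := fun q hq => by
    have h1 : (q.1 : ℝ) ≤ q.2 := by exact_mod_cast ((hmem q).1 hq).1
    have h2 : (q.2 : ℝ) < n := by exact_mod_cast ((hmem q).1 hq).2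
    exact one_le_oscillationBarrier (by linarith) (by linarith [q.1.cast_nonneg (α := ℝ)])
  have hexp : ∀ s : ℝ, HasDerivAt (fun s => 2 * A * Real.exp (-2 * s))
      (-2 * (2 * A * Real.exp (-2 * s))) s := fun s =>
    ((((hasDerivAt_id s).const_mul (-2)).exp).const_mul (2 * A)).congr_deriv
      (by simp only [id]; ring)
  have hcompare := nonpos_of_deriv_nonpos_at_max (S := S)
    (w := fun s q => v s q.1 - v s q.2 -
      2 * A * Real.exp (-2 * s) * oscillationBarrier n ((q.2 : ℝ) - q.1))
    (fun s hs q hq => ((hv s hs q.1 (((hmem q).1 hq).1.trans_lt ((hmem q).1 hq).2)).sub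
      (hv s hs q.2 ((hmem q).1 hq).2)).sub ((hexp s).mul_const _)) ?_ ?_ ht
    ((hmem (k, l)).2 ⟨hkl, hl⟩)
  · have := mul_le_mul_of_nonneg_left (oscillationBarrier_le_two n ((l : ℝ) - k))
      (show 0 ≤ 2 * A * Real.exp (-2 * t) by positivity)
    linarith
  · intro q hq
    have h1 := abs_le.1 (h0 q.1 (((hmem q).1 hq).1.trans_lt ((hmem q).1 hq).2))
    have h2 := abs_le.1 (h0 q.2 ((hmem q).1 hq).2)
    simp only [mul_zero, Real.exp_zero, mul_one]
    linarith [mul_le_mul_of_nonneg_left (hg1 q hq) (show 0 ≤ 2 * A by positivity)]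
  · intro s _ q hq hpos hmax
    have hB : 0 ≤ 2 * A * Real.exp (-2 * s) := by positivity
    have hne : q.1 < q.2 := ((hmem q).1 hq).1.lt_of_ne fun h => by
      have := mul_nonneg hB (zero_le_one.trans (hg1 q hq))
      rw [h] at hpos this
      linarith
    have hlap := reflectedLaplacian_sub_le_at_max hB hne ((hmem q).1 hq).2
      fun i j hij hj => hmax (i, j) ((hmem (i, j)).2 ⟨hij, hj⟩)
    have := mul_le_mul_of_nonneg_left (oscillationBarrier_le_two n ((q.2 : ℝ) - q.1)) hB
    linarith

theorem abs_le_of_hasDerivAt_reflectedLaplacian (hA : 0 ≤ A)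
    (hv : ∀ t, 0 ≤ t → ∀ k < n, HasDerivAt (fun s => v s k) (reflectedLaplacian n (v t) k) t)
    (h0 : ∀ k < n, |v 0 k| ≤ A) {t : ℝ} (ht : 0 ≤ t) (hsum : ∑ k ∈ Finset.range n, v t k = 0)
    {k : ℕ} (hk : k < n) : |v t k| ≤ 4 * A * Real.exp (-2 * t) := by
  have hv_neg : ∀ t, 0 ≤ t → ∀ k < n, HasDerivAt (fun s => -v s k)
      (reflectedLaplacian n (fun k => -v t k) k) t := fun t ht k hk =>
    (hv t ht k hk).neg.congr_deriv (by unfold reflectedLaplacian; split_ifs <;> ring)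
  have h0_neg : ∀ k < n, |-v 0 k| ≤ A := fun k hk => by simpa using h0 k hk
  have hosc : ∀ i j, i ≤ j → j < n → |v t i - v t j| ≤ 4 * A * Real.exp (-2 * t) :=
    fun i j hij hj => abs_le.2
      ⟨by linarith [sub_le_of_hasDerivAt_reflectedLaplacian hA hv_neg h0_neg ht hij hj],
        sub_le_of_hasDerivAt_reflectedLaplacian hA hv h0 ht hij hj⟩
  have hdist : ∀ l ∈ Finset.range n, |v t k - v t l| ≤ 4 * A * Real.exp (-2 * t) := by
    intro l hl
    rcases le_total k l with h | h
    · exact hosc k l h (Finset.mem_range.1 hl)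
    · rw [abs_sub_comm]
      exact hosc l k h hk
  have hn : (0 : ℝ) < n := by exact_mod_cast k.zero_le.trans_lt hk
  refine le_of_mul_le_mul_left ?_ hn
  calc n * |v t k| = |∑ l ∈ Finset.range n, (v t k - v t l)| := by
        rw [Finset.sum_sub_distrib, hsum]
        simp [abs_mul]
    _ ≤ ∑ l ∈ Finset.range n, |v t k - v t l| := Finset.abs_sum_le_sum_abs _ _
    _ ≤ ∑ _l ∈ Finset.range n, 4 * A * Real.exp (-2 * t) := Finset.sum_le_sum hdist
    _ = n * (4 * A * Real.exp (-2 * t)) := by simp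

end ReflectedHeatEquation

/-! ### Exchanges and flips -/

section Configurations

variable {n : ℕ}

theorem exchange_left (x y : Site n) (η : Config n) : exchange x y η x = η y := by
  simp [exchange]

theorem exchange_right (x y : Site n) (η : Config n) : exchange x y η y = η x := by
  simp [exchange]

theorem exchange_of_ne {x y z : Site n} (hx : z ≠ x) (hy : z ≠ y) (η : Config n) :
    exchange x y η z = η z := by
  simp [exchange, Equiv.swap_apply_of_ne_of_ne hx hy]

theorem exchange_involutive (x y : Site n) : Function.Involutive (exchange x y) := fun η => by
  funext z
  simp [exchange]

theorem flip_self (x : Site n) (η : Config n) : flip x η x = !η x := by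
  simp [flip]

theorem flip_of_ne {x z : Site n} (h : z ≠ x) (η : Config n) : flip x η z = η z := by
  simp [flip, h]

theorem flip_involutive (x : Site n) : Function.Involutive (flip x) := fun η => by
  simp [flip]

theorem sum_comp_exchange (x y : Site n) (F : Config n → ℝ) :
    ∑ η, F (exchange x y η) = ∑ η, F η :=
  Equiv.sum_comp (exchange_involutive x y).toPerm F

theorem sum_comp_flip (x : Site n) (F : Config n → ℝ) : ∑ η, F (flip x η) = ∑ η, F η :=
  Equiv.sum_comp (flip_involutive x).toPerm F

theorem occ_mul_self (b : Bool) : occ b * occ b = occ b := by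
  cases b <;> simp [occ]

end Configurations

/-! ### Bonds and summation by parts -/

/-- The nearest-neighbour pairs `(x, x + 1)` of the bulk, along which particles are exchanged. -/
def bonds (n : ℕ) : Finset (Site n × Site n) := Finset.univ.filter fun b => b.2.1 = b.1.1 + 1

/-- The set `{1, n - 1}` of the sites in contact with a reservoir. -/
def boundary (n : ℕ) : Finset (Site n) := Finset.univ.filter fun x => x.1 = 1 ∨ x.1 + 1 = n

section Bonds

variable {n : ℕ}

theorem mem_bonds {b : Site n × Site n} : b ∈ bonds n ↔ b.2.1 = b.1.1 + 1 := by
  simp [bonds]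

theorem mem_boundary {x : Site n} : x ∈ boundary n ↔ x.1 = 1 ∨ x.1 + 1 = n := by
  simp [boundary]

theorem ne_of_mem_bonds {b : Site n × Site n} (hb : b ∈ bonds n) : b.1 ≠ b.2 := fun h => by
  have := mem_bonds.1 hb
  rw [h] at this
  omega

theorem sum_bonds_fst (G : Site n → ℕ → ℝ) :
    ∑ b ∈ bonds n, G b.1 b.2.1 = ∑ x, if x.1 + 1 < n then G x (x.1 + 1) else 0 := by
  rw [← Finset.sum_filter]
  refine Finset.sum_nbij Prod.fst (fun b hb => ?_) (fun b hb c hc h => ?_) (fun x hx => ?_)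
    (fun b hb => by rw [mem_bonds.1 hb])
  · simpa [← mem_bonds.1 hb] using (Finset.mem_Ioo.1 b.2.2).2
  · refine Prod.ext h (Subtype.ext ?_)
    rw [mem_bonds.1 hb, mem_bonds.1 hc, h]
  · exact ⟨(x, ⟨x.1 + 1, by simpa using hx⟩), by simp [mem_bonds]⟩

theorem sum_bonds_snd (G : Site n → ℕ → ℝ) :
    ∑ b ∈ bonds n, G b.2 b.1.1 = ∑ x, if 1 < x.1 then G x (x.1 - 1) else 0 := by
  rw [← Finset.sum_filter]
  refine Finset.sum_nbij Prod.snd (fun b hb => ?_) (fun b hb c hc h => ?_) (fun x hx => ?_)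
    (fun b hb => by rw [mem_bonds.1 hb, Nat.add_sub_cancel])
  · simpa [mem_bonds.1 hb] using (Finset.mem_Ioo.1 b.1.2).1
  · refine Prod.ext (Subtype.ext ?_) h
    have := mem_bonds.1 hb
    have := mem_bonds.1 hc
    have := congrArg Subtype.val h
    omega
  · have hx' : 1 < x.1 := by simpa using hx
    have hxn := (Finset.mem_Ioo.1 x.2).2
    refine ⟨(⟨x.1 - 1, Finset.mem_Ioo.2 (by omega)⟩, x), ?_, rfl⟩
    simp only [Finset.mem_coe, mem_bonds]
    omega

theorem card_bonds_le (n : ℕ) : (bonds n).card ≤ n := by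
  have : (bonds n).card ≤ (Finset.univ : Finset (Site n)).card :=
    Finset.card_le_card_of_injOn Prod.fst (fun _ _ => Finset.mem_univ _) fun b hb c hc h =>
      Prod.ext h (Subtype.ext (by rw [mem_bonds.1 hb, mem_bonds.1 hc, h]))
  exact this.trans (by simp)

theorem sum_discreteLaplacian_mul (hn : 3 ≤ n) {ρ : ℝ} {U : ℕ → ℝ} (h0 : U 0 = ρ)
    (h1 : U n = ρ) (s : Site n → ℝ) :
    ∑ x : Site n, discreteLaplacian n U x.1 * s x =
      (n : ℝ) ^ 2 * ∑ b ∈ bonds n, (U b.2.1 - U b.1.1) * (s b.1 - s b.2) +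
      (n : ℝ) ^ 2 * ∑ x ∈ boundary n, (ρ - U x.1) * s x := by
  have hbonds : ∑ b ∈ bonds n, (U b.2.1 - U b.1.1) * (s b.1 - s b.2) =
      (∑ b ∈ bonds n, (U b.2.1 - U b.1.1) * s b.1) +
        ∑ b ∈ bonds n, (U b.1.1 - U b.2.1) * s b.2 := by
    rw [← Finset.sum_add_distrib]
    exact Finset.sum_congr rfl fun b _ => by ring
  rw [hbonds, sum_bonds_fst fun x k => (U k - U x.1) * s x,
    sum_bonds_snd fun x k => (U k - U x.1) * s x, boundary, Finset.sum_filter, ← mul_add,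
    ← Finset.sum_add_distrib, ← Finset.sum_add_distrib, Finset.mul_sum]
  refine Finset.sum_congr rfl fun x _ => ?_
  have hx := Finset.mem_Ioo.1 x.2
  rw [discreteLaplacian, mul_assoc]
  congr 1
  by_cases hleft : x.1 = 1
  · rw [hleft, if_pos (by omega), if_neg (by omega), if_pos (by omega), Nat.sub_self, h0]
    ring
  · by_cases hright : x.1 + 1 = n
    · rw [hright, if_neg (by omega), if_pos (by omega), if_pos (by omega), h1]
      ring
    · rw [if_pos (by omega), if_pos (by omega), if_neg (by omega)]
      ring

end Bonds

/-! ### The generator on one- and two-point functions -/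

/-- The rate `ρ (1 - b) + (1 - ρ) b` at which a reservoir of density `ρ` flips the content `b`. -/
def rate (ρ : ℝ) (b : Bool) : ℝ := ρ * (1 - occ b) + (1 - ρ) * occ b

theorem rate_mem_Icc {ε ρ : ℝ} (h : ρ ∈ Icc ε (1 - ε)) (b : Bool) : rate ρ b ∈ Icc ε (1 - ε) := by
  cases b <;> simp only [rate, occ] <;> constructor <;> norm_num <;> linarith [h.1, h.2]

theorem rate_mul_occ_not_sub (ρ : ℝ) (b : Bool) : rate ρ b * (occ (!b) - occ b) = ρ - occ b := by
  cases b <;> simp [rate, occ]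

section Generator

variable {n : ℕ}

theorem generator_apply (ρ : ℝ) (f : Config n → ℝ) (η : Config n) :
    generator n ρ f η =
      (n : ℝ) ^ 2 * ∑ b ∈ bonds n, (f (exchange b.1 b.2 η) - f η) +
      (n : ℝ) ^ 2 * ∑ x ∈ boundary n, rate ρ (η x) * (f (flip x η) - f η) := by
  rw [bonds, boundary, Finset.sum_filter, Finset.sum_filter, Fintype.sum_prod_type]
  rfl

theorem generator_const (ρ c : ℝ) : generator n ρ (fun _ => c) = 0 := by
  funext η
  simp [generator_apply]

theorem generator_mul (ρ : ℝ) (f g : Config n → ℝ) (η : Config n) :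
    generator n ρ (fun ξ => f ξ * g ξ) η =
      f η * generator n ρ g η + g η * generator n ρ f η +
      ((n : ℝ) ^ 2 * ∑ b ∈ bonds n,
          (f (exchange b.1 b.2 η) - f η) * (g (exchange b.1 b.2 η) - g η) +
        (n : ℝ) ^ 2 * ∑ x ∈ boundary n,
          rate ρ (η x) * ((f (flip x η) - f η) * (g (flip x η) - g η))) := by
  have hbonds : ∑ b ∈ bonds n, (f (exchange b.1 b.2 η) * g (exchange b.1 b.2 η) - f η * g η) =
      f η * ∑ b ∈ bonds n, (g (exchange b.1 b.2 η) - g η) +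
      g η * ∑ b ∈ bonds n, (f (exchange b.1 b.2 η) - f η) +
      ∑ b ∈ bonds n, (f (exchange b.1 b.2 η) - f η) * (g (exchange b.1 b.2 η) - g η) := by
    rw [Finset.mul_sum, Finset.mul_sum, ← Finset.sum_add_distrib, ← Finset.sum_add_distrib]
    exact Finset.sum_congr rfl fun b _ => by ring
  have hboundary : ∑ x ∈ boundary n, rate ρ (η x) * (f (flip x η) * g (flip x η) - f η * g η) =
      f η * ∑ x ∈ boundary n, rate ρ (η x) * (g (flip x η) - g η) +
      g η * ∑ x ∈ boundary n, rate ρ (η x) * (f (flip x η) - f η) +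
      ∑ x ∈ boundary n, rate ρ (η x) * ((f (flip x η) - f η) * (g (flip x η) - g η)) := by
    rw [Finset.mul_sum, Finset.mul_sum, ← Finset.sum_add_distrib, ← Finset.sum_add_distrib]
    exact Finset.sum_congr rfl fun x _ => by ring
  rw [generator_apply, generator_apply, generator_apply, hbonds, hboundary]
  ring

theorem sum_mul_generator (ρ : ℝ) (μ f : Config n → ℝ) :
    ∑ η, μ η * generator n ρ f η =
      (n : ℝ) ^ 2 * ∑ b ∈ bonds n, ∑ η, μ η * (f (exchange b.1 b.2 η) - f η) +
      (n : ℝ) ^ 2 * ∑ x ∈ boundary n, ∑ η, μ η * (rate ρ (η x) * (f (flip x η) - f η)) := by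
  rw [Finset.sum_comm, Finset.sum_comm (s := boundary n), Finset.mul_sum, Finset.mul_sum,
    ← Finset.sum_add_distrib]
  refine Finset.sum_congr rfl fun η _ => ?_
  rw [generator_apply, ← Finset.mul_sum, ← Finset.mul_sum]
  ring

/-- The occupation numbers as a function on `ℕ`, with the reservoir density `ρ` as value outside
the bulk, so that the discrete Laplacian can be applied to them. -/
def extOcc (ρ : ℝ) (η : Config n) (k : ℕ) : ℝ :=
  if h : k ∈ Finset.Ioo 0 n then occ (η ⟨k, h⟩) else ρ

theorem extOcc_site (ρ : ℝ) (η : Config n) (z : Site n) : extOcc ρ η z.1 = occ (η z) :=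
  dif_pos z.2

theorem extOcc_of_notMem (ρ : ℝ) (η : Config n) {k : ℕ} (h : k ∉ Finset.Ioo 0 n) :
    extOcc ρ η k = ρ := dif_neg h

theorem occ_exchange_sub (x y z : Site n) (η : Config n) :
    occ (exchange x y η z) - occ (η z) =
      (occ (η y) - occ (η x)) * ((Pi.single z 1 : Site n → ℝ) x - (Pi.single z 1 : Site n → ℝ) y)
    := by
  rcases eq_or_ne z x with rfl | hx
  · rcases eq_or_ne z y with rfl | hy
    · simp [exchange]
    · simp [exchange_left, hy.symm]
  · rcases eq_or_ne z y with rfl | hy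
    · simp [exchange_right, hx.symm]
    · simp [exchange_of_ne hx hy, hx.symm, hy.symm]

theorem rate_mul_occ_flip_sub (ρ : ℝ) (x z : Site n) (η : Config n) :
    rate ρ (η x) * (occ (flip x η z) - occ (η z)) =
      (ρ - occ (η x)) * (Pi.single z 1 : Site n → ℝ) x := by
  rcases eq_or_ne z x with rfl | hx
  · simp [flip_self, rate_mul_occ_not_sub]
  · simp [flip_of_ne hx, hx.symm]

theorem generator_occ (hn : 3 ≤ n) (ρ : ℝ) (z : Site n) (η : Config n) :
    generator n ρ (fun ξ => occ (ξ z)) η = discreteLaplacian n (extOcc ρ η) z.1 := by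
  have hparts := sum_discreteLaplacian_mul hn (extOcc_of_notMem ρ η (k := 0) (by simp))
    (extOcc_of_notMem ρ η (k := n) (by simp)) (Pi.single z 1)
  simp only [extOcc_site, ← occ_exchange_sub, ← rate_mul_occ_flip_sub] at hparts
  rw [generator_apply, ← hparts]
  simp [Pi.single_apply]

-- Only the exchange of `z` and `w` moves both occupation numbers.
theorem generator_occ_mul_occ (ρ : ℝ) {z w : Site n} (hzw : z.1 < w.1) (η : Config n) :
    generator n ρ (fun ξ => occ (ξ z) * occ (ξ w)) η =
      occ (η z) * generator n ρ (fun ξ => occ (ξ w)) η +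
      occ (η w) * generator n ρ (fun ξ => occ (ξ z)) η -
      (if w.1 = z.1 + 1 then (n : ℝ) ^ 2 * (occ (η z) - occ (η w)) ^ 2 else 0) := by
  have hne : z ≠ w := fun h => hzw.ne (congrArg Subtype.val h)
  have hflip : ∀ x ∈ boundary n, rate ρ (η x) *
      ((occ (flip x η z) - occ (η z)) * (occ (flip x η w) - occ (η w))) = 0 := fun x _ => by
    rcases eq_or_ne z x with rfl | hx
    · simp [flip_of_ne hne.symm]
    · simp [flip_of_ne hx]
  have hexchange : ∀ b ∈ bonds n, (occ (exchange b.1 b.2 η z) - occ (η z)) *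
      (occ (exchange b.1 b.2 η w) - occ (η w)) =
      if b = (z, w) then -(occ (η z) - occ (η w)) ^ 2 else 0 := by
    rintro ⟨x, y⟩ hb
    have hyx : y.1 = x.1 + 1 := mem_bonds.1 hb
    split_ifs with h
    · obtain ⟨rfl, rfl⟩ := Prod.mk.inj h
      rw [exchange_left, exchange_right]
      ring
    · rw [mul_eq_zero]
      by_contra! hboth
      have hz : z = x ∨ z = y := by
        by_contra! hz
        exact hboth.1 (by rw [exchange_of_ne hz.1 hz.2, sub_self])
      have hw : w = x ∨ w = y := by
        by_contra! hw
        exact hboth.2 (by rw [exchange_of_ne hw.1 hw.2, sub_self])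
      rcases hz with rfl | rfl <;> rcases hw with rfl | rfl <;> first | exact h rfl | omega
  rw [generator_mul, Finset.sum_congr rfl hexchange, Finset.sum_eq_zero hflip,
    Finset.sum_ite_eq']
  simp only [mem_bonds]
  split_ifs <;> ring

end Generator

/-! ### Bernoulli product weights -/

/-- The weight of the content `b` of a site of density `a`. -/
def siteWeight (a : ℝ) (b : Bool) : ℝ := occ b * a + (1 - occ b) * (1 - a)

/-- The weight of a configuration under the Bernoulli product measure of density `u`. -/
def weight {n : ℕ} (u : Site n → ℝ) (η : Config n) : ℝ := ∏ x, siteWeight (u x) (η x)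

/-- The normalized centred occupation number `(b - a) / (a (1 - a))`, encoded as the logarithmic
derivative in `a` of the site weight. -/
def score (a : ℝ) (b : Bool) : ℝ := (2 * occ b - 1) / siteWeight a b

theorem siteWeight_mem_Icc {ε a : ℝ} (h : a ∈ Icc ε (1 - ε)) (b : Bool) :
    siteWeight a b ∈ Icc ε (1 - ε) := by
  cases b <;> simp only [siteWeight, occ] <;> constructor <;> norm_num <;> linarith [h.1, h.2]

theorem siteWeight_pos {ε a : ℝ} (hε : 0 < ε) (h : a ∈ Icc ε (1 - ε)) (b : Bool) :
    0 < siteWeight a b := hε.trans_le (siteWeight_mem_Icc h b).1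

theorem siteWeight_add_siteWeight_not (a : ℝ) (b : Bool) :
    siteWeight a b + siteWeight a (!b) = 1 := by
  cases b <;> simp [siteWeight, occ]

theorem score_eq_div {a : ℝ} (h0 : 0 < a) (h1 : a < 1) (b : Bool) :
    score a b = (occ b - a) / (a * (1 - a)) := by
  have : 1 - a ≠ 0 := by linarith
  cases b <;> simp [score, siteWeight, occ] <;> field_simp; norm_num

section Weight

variable {n : ℕ} {u : Site n → ℝ}

theorem weight_pos (hw : ∀ x b, 0 < siteWeight (u x) b) (η : Config n) : 0 < weight u η :=
  Finset.prod_pos fun x _ => hw x (η x)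

theorem sum_weight_eq_one (u : Site n → ℝ) : ∑ η, weight u η = 1 := by
  have h : ∏ x : Site n, ∑ b : Bool, siteWeight (u x) b = ∑ η : Config n, weight u η :=
    Fintype.prod_sum _
  rw [← h]
  refine Finset.prod_eq_one fun x _ => ?_
  rw [Fintype.sum_bool]
  exact siteWeight_add_siteWeight_not (u x) true

theorem weight_flip (u : Site n → ℝ) (x : Site n) (η : Config n) :
    weight u (flip x η) * siteWeight (u x) (η x) = weight u η * siteWeight (u x) (!η x) := by
  have hrest : ∏ z ∈ {x}ᶜ, siteWeight (u z) (flip x η z) =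
      ∏ z ∈ {x}ᶜ, siteWeight (u z) (η z) :=
    Finset.prod_congr rfl fun z hz => by rw [flip_of_ne (by simpa using hz)]
  rw [weight, weight, Fintype.prod_eq_mul_prod_compl x, hrest,
    Fintype.prod_eq_mul_prod_compl x fun z => siteWeight (u z) (η z), flip_self]
  ring

theorem weight_exchange (u : Site n → ℝ) {x y : Site n} (hxy : x ≠ y) (η : Config n) :
    weight u (exchange x y η) * (siteWeight (u x) (η x) * siteWeight (u y) (η y)) =
      weight u η * (siteWeight (u x) (η y) * siteWeight (u y) (η x)) := by
  have hsplit : ∀ F : Site n → ℝ, ∏ z, F z = F x * F y * ∏ z ∈ {x, y}ᶜ, F z := fun F => by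
    rw [← Finset.prod_mul_prod_compl {x, y}, Finset.prod_pair hxy]
  have hrest : ∏ z ∈ {x, y}ᶜ, siteWeight (u z) (exchange x y η z) =
      ∏ z ∈ {x, y}ᶜ, siteWeight (u z) (η z) := by
    refine Finset.prod_congr rfl fun z hz => ?_
    simp only [Finset.mem_compl, Finset.mem_insert, Finset.mem_singleton, not_or] at hz
    rw [exchange_of_ne hz.1 hz.2]
  rw [weight, weight, hsplit, hsplit fun z => siteWeight (u z) (η z), hrest, exchange_left,
    exchange_right]
  ring

theorem weight_exchange_sub {x y : Site n} (hxy : x ≠ y) {η : Config n}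
    (hx : siteWeight (u x) (η x) ≠ 0) (hy : siteWeight (u y) (η y) ≠ 0) :
    weight u (exchange x y η) - weight u η = weight u η *
      ((u y - u x) * (score (u x) (η x) - score (u y) (η y)) -
        (u y - u x) ^ 2 * (score (u x) (η x) * score (u y) (η y))) := by
  have hsite : siteWeight (u x) (η y) * siteWeight (u y) (η x) -
      siteWeight (u x) (η x) * siteWeight (u y) (η y) =
      (u y - u x) * ((2 * occ (η x) - 1) * siteWeight (u y) (η y) -
        siteWeight (u x) (η x) * (2 * occ (η y) - 1)) -
      (u y - u x) ^ 2 * ((2 * occ (η x) - 1) * (2 * occ (η y) - 1)) := by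
    cases η x <;> cases η y <;> simp [siteWeight, occ] <;> ring
  apply mul_right_cancel₀ (mul_ne_zero hx hy)
  rw [sub_mul, weight_exchange u hxy η, ← mul_sub, hsite, score, score]
  field_simp

theorem weight_flip_mul_rate_sub (ρ : ℝ) {x : Site n} {η : Config n}
    (hx : siteWeight (u x) (η x) ≠ 0) :
    weight u (flip x η) * rate ρ (!η x) - weight u η * rate ρ (η x) =
      weight u η * ((ρ - u x) * score (u x) (η x)) := by
  have hsite : siteWeight (u x) (!η x) * rate ρ (!η x) - siteWeight (u x) (η x) * rate ρ (η x) =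
      (ρ - u x) * (2 * occ (η x) - 1) := by
    cases η x <;> simp [siteWeight, occ, rate] <;> ring
  apply mul_right_cancel₀ hx
  calc _ = (weight u (flip x η) * siteWeight (u x) (η x)) * rate ρ (!η x) -
        weight u η * (siteWeight (u x) (η x) * rate ρ (η x)) := by ring
    _ = weight u η * ((ρ - u x) * (2 * occ (η x) - 1)) := by rw [weight_flip, ← hsite]; ring
    _ = _ := by rw [score]; field_simp

end Weight

/-! ### Subadditivity of the entropy -/

/-- The average of `h` over the content of the site `x`. -/
def condAvg {n : ℕ} (u : Site n → ℝ) (x : Site n) (h : Config n → ℝ) (η : Config n) : ℝ :=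
  siteWeight (u x) true * h (Function.update η x true) +
    siteWeight (u x) false * h (Function.update η x false)

/-- The entropy of `f` as a function of the content of the site `x` alone. -/
def condEntropy {n : ℕ} (u : Site n → ℝ) (x : Site n) (f : Config n → ℝ) (η : Config n) : ℝ :=
  condAvg u x (fun ξ => f ξ * Real.log (f ξ)) η - condAvg u x f η * Real.log (condAvg u x f η)

section CondAvg

variable {n : ℕ} {u : Site n → ℝ}

theorem condAvg_eq (u : Site n → ℝ) (x : Site n) (h : Config n → ℝ) (η : Config n) :
    condAvg u x h η = siteWeight (u x) (η x) * h η + siteWeight (u x) (!η x) * h (flip x η) := by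
  have hη : Function.update η x (η x) = η := Function.update_eq_self x η
  cases hb : η x <;> simp only [hb] at hη <;>
    simp only [condAvg, flip, hη, hb, Bool.not_false, Bool.not_true, add_comm]

theorem condAvg_update (u : Site n → ℝ) (x : Site n) (h : Config n → ℝ) (η : Config n) (b : Bool) :
    condAvg u x h (Function.update η x b) = condAvg u x h η := by
  simp [condAvg]

theorem condAvg_pos (hw : ∀ x b, 0 < siteWeight (u x) b) {h : Config n → ℝ} (hh : ∀ η, 0 < h η)
    (x : Site n) (η : Config n) : 0 < condAvg u x h η :=
  add_pos (mul_pos (hw x _) (hh _)) (mul_pos (hw x _) (hh _))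

theorem dependsOn_condAvg {h : Config n → ℝ} {s : Set (Site n)} (hh : DependsOn h s)
    (x : Site n) : DependsOn (condAvg u x h) (s \ {x}) := by
  intro η ξ hηξ
  have hupdate : ∀ b, h (Function.update η x b) = h (Function.update ξ x b) := fun b =>
    hh fun y hy => by
      rcases eq_or_ne y x with rfl | hyx
      · simp
      · simpa [hyx] using hηξ y ⟨hy, hyx⟩
  simp only [condAvg, hupdate]

theorem sum_weight_mul_condAvg (u : Site n → ℝ) (x : Site n) (h : Config n → ℝ) :
    ∑ η, weight u η * condAvg u x h η = ∑ η, weight u η * h η := by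
  have hflip : ∑ η, weight u η * (siteWeight (u x) (!η x) * h (flip x η)) =
      ∑ η, weight u (flip x η) * (siteWeight (u x) (η x) * h η) := by
    rw [← sum_comp_flip x]
    simp only [(flip_involutive x) _, flip_self, Bool.not_not]
  simp only [condAvg_eq, mul_add, Finset.sum_add_distrib]
  rw [hflip, ← Finset.sum_add_distrib]
  refine Finset.sum_congr rfl fun η _ => ?_
  linear_combination h η * weight_flip u x η +
    weight u η * h η * siteWeight_add_siteWeight_not (u x) (η x)

end CondAvg

theorem mul_log_sub_log_le_gibbs {c t m σ : ℝ} (hc : 0 < c) (ht : 0 < t) (hm : 0 < m)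
    (hσ : 0 < σ) :
    c * (Real.log t - Real.log σ - (Real.log c - Real.log m)) ≤ t * m / σ - c := by
  have h := Real.log_le_sub_one_of_pos (show 0 < t * m / (σ * c) by positivity)
  rw [Real.log_div (by positivity) (by positivity), Real.log_mul ht.ne' hm.ne',
    Real.log_mul hσ.ne' hc.ne'] at h
  calc _ = c * (Real.log t + Real.log m - (Real.log σ + Real.log c)) := by ring
    _ ≤ c * (t * m / (σ * c) - 1) := by gcongr
    _ = t * m / σ - c := by field_simp

theorem pair_gibbs {p q a b s r : ℝ} (hp : 0 < p) (hq : 0 < q) (ha : 0 < a) (hb : 0 < b)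
    (hs : 0 < s) (hr : 0 < r) :
    p * (a * (Real.log s - Real.log (p * s + q * r))) +
      q * (b * (Real.log r - Real.log (p * s + q * r))) ≤
    p * (a * Real.log a) + q * (b * Real.log b) -
      (p * a + q * b) * Real.log (p * a + q * b) := by
  have hm : 0 < p * a + q * b := by positivity
  have hσ : 0 < p * s + q * r := by positivity
  have ha' := mul_le_mul_of_nonneg_left (mul_log_sub_log_le_gibbs ha hs hm hσ) hp.le
  have hb' := mul_le_mul_of_nonneg_left (mul_log_sub_log_le_gibbs hb hr hm hσ) hq.le
  have hcancel : p * (s * (p * a + q * b) / (p * s + q * r) - a) +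
      q * (r * (p * a + q * b) / (p * s + q * r) - b) = 0 := by
    field_simp
    ring
  linarith

section Entropy

variable {n : ℕ} {u : Site n → ℝ} {f : Config n → ℝ}

theorem sum_weight_mul_log_sub_log_condAvg_le (hw : ∀ x b, 0 < siteWeight (u x) b)
    (hf : ∀ η, 0 < f η) {S : Config n → ℝ} (hS : ∀ η, 0 < S η) (x : Site n) :
    ∑ η, weight u η * (f η * (Real.log (S η) - Real.log (condAvg u x S η))) ≤
      ∑ η, weight u η * condEntropy u x f η := by
  rw [← sum_weight_mul_condAvg u x]
  refine Finset.sum_le_sum fun η _ => mul_le_mul_of_nonneg_left ?_ (weight_pos hw η).le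
  rw [condAvg.eq_1 u x fun η => f η * (Real.log (S η) - Real.log (condAvg u x S η)),
    condAvg_update, condAvg_update]
  exact pair_gibbs (hw x true) (hw x false) (hf _) (hf _) (hS _) (hS _)

-- The sites of `s` are averaged out one after the other.
theorem exists_dependsOn_compl_sum_le (hw : ∀ x b, 0 < siteWeight (u x) b) (hf : ∀ η, 0 < f η)
    (s : Finset (Site n)) :
    ∃ S : Config n → ℝ, (∀ η, 0 < S η) ∧ DependsOn S (s : Set (Site n))ᶜ ∧
      ∑ η, weight u η * S η = ∑ η, weight u η * f η ∧
      ∑ η, weight u η * (f η * (Real.log (f η) - Real.log (S η))) ≤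
        ∑ x ∈ s, ∑ η, weight u η * condEntropy u x f η := by
  induction s using Finset.induction_on with
  | empty => exact ⟨f, hf, by simpa using dependsOn_univ f, rfl, by simp⟩
  | insert x s hx ih =>
    obtain ⟨S, hS, hdep, hsum, hle⟩ := ih
    refine ⟨condAvg u x S, condAvg_pos hw hS x, ?_, ?_, ?_⟩
    · convert dependsOn_condAvg (u := u) hdep x using 1
      ext y
      simp [and_comm]
    · rw [sum_weight_mul_condAvg, hsum]
    · rw [Finset.sum_insert hx]
      refine le_of_eq_of_le ?_
        (add_le_add (sum_weight_mul_log_sub_log_condAvg_le hw hf hS x) hle)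
      rw [← Finset.sum_add_distrib]
      exact Finset.sum_congr rfl fun η _ => by ring

theorem sum_weight_mul_log_le_sum_condEntropy (hw : ∀ x b, 0 < siteWeight (u x) b)
    (hf : ∀ η, 0 < f η) (hf1 : ∑ η, weight u η * f η = 1) :
    ∑ η, weight u η * (f η * Real.log (f η)) ≤ ∑ x, ∑ η, weight u η * condEntropy u x f η := by
  obtain ⟨S, -, hdep, hsum, hle⟩ := exists_dependsOn_compl_sum_le hw hf Finset.univ
  have hone : ∀ η, S η = 1 := fun η => by
    have hconst : ∀ ξ, S ξ = S η := fun ξ => hdep (by simp)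
    simpa [hconst, ← Finset.sum_mul, sum_weight_eq_one, hf1] using hsum
  simpa [hone] using hle

/-! ### A logarithmic Sobolev inequality for flips -/

theorem sq_sub_le_mul_sq_sqrt_sub_sqrt {a b : ℝ} (ha : 0 ≤ a) (hb : 0 ≤ b) :
    (a - b) ^ 2 ≤ 2 * (a + b) * (√a - √b) ^ 2 := by
  have hsa := Real.sq_sqrt ha
  have hsb := Real.sq_sqrt hb
  calc (a - b) ^ 2 = (√a + √b) ^ 2 * (√a - √b) ^ 2 := by
        rw [← mul_pow, ← sq_sub_sq, hsa, hsb]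
    _ ≤ 2 * (a + b) * (√a - √b) ^ 2 := by
        gcongr
        linarith [sq_nonneg (√a - √b)]

theorem pair_entropy_le_sq_div {p q a b : ℝ} (hp : 0 < p) (hq : 0 < q) (hpq : p + q = 1)
    (ha : 0 < a) (hb : 0 < b) :
    p * (a * Real.log a) + q * (b * Real.log b) -
      (p * a + q * b) * Real.log (p * a + q * b) ≤ p * q * (a - b) ^ 2 / (p * a + q * b) := by
  set m := p * a + q * b with hm
  have hm0 : 0 < m := by positivity
  have hlog : ∀ c, 0 < c → c * (Real.log c - Real.log m) ≤ c * (c / m - 1) := fun c hc => by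
    have := Real.log_le_sub_one_of_pos (div_pos hc hm0)
    rw [Real.log_div hc.ne' hm0.ne'] at this
    gcongr
  have ha' := mul_le_mul_of_nonneg_left (hlog a ha) hp.le
  have hb' := mul_le_mul_of_nonneg_left (hlog b hb) hq.le
  have hvar : p * (a * (a / m - 1)) + q * (b * (b / m - 1)) = p * q * (a - b) ^ 2 / m := by
    obtain rfl : q = 1 - p := by linarith
    field_simp
    rw [hm]
    ring
  have hexpand : p * (a * (Real.log a - Real.log m)) + q * (b * (Real.log b - Real.log m)) =
      p * (a * Real.log a) + q * (b * Real.log b) - m * Real.log m := by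
    rw [hm]
    ring
  linarith [hexpand]

theorem pair_entropy_le {ε p q a b : ℝ} (hε : 0 < ε) (hp : ε ≤ p) (hq : ε ≤ q) (hpq : p + q = 1)
    (ha : 0 < a) (hb : 0 < b) :
    p * (a * Real.log a) + q * (b * Real.log b) -
      (p * a + q * b) * Real.log (p * a + q * b) ≤ 2 / ε * (√a - √b) ^ 2 := by
  have hp0 := hε.trans_le hp
  have hq0 := hε.trans_le hq
  have hmean : ε * (a + b) ≤ p * a + q * b := by
    linarith [mul_le_mul_of_nonneg_right hp ha.le, mul_le_mul_of_nonneg_right hq hb.le]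
  refine (pair_entropy_le_sq_div hp0 hq0 hpq ha hb).trans ?_
  calc p * q * (a - b) ^ 2 / (p * a + q * b)
      ≤ 1 * (2 * (a + b) * (√a - √b) ^ 2) / (ε * (a + b)) := by
        gcongr
        · exact mul_le_one₀ (by linarith) hq0.le (by linarith)
        · exact sq_sub_le_mul_sq_sqrt_sub_sqrt ha.le hb.le
    _ = 2 / ε * (√a - √b) ^ 2 := by field_simp

theorem sum_weight_mul_log_le_sum_flip {ε : ℝ} (hε : 0 < ε) (hu : ∀ x, u x ∈ Icc ε (1 - ε))
    (hf : ∀ η, 0 < f η) (hf1 : ∑ η, weight u η * f η = 1) :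
    ∑ η, weight u η * (f η * Real.log (f η)) ≤
      2 / ε * ∑ x, ∑ η, weight u η * (√(f (flip x η)) - √(f η)) ^ 2 := by
  have hw : ∀ x b, 0 < siteWeight (u x) b := fun x => siteWeight_pos hε (hu x)
  refine (sum_weight_mul_log_le_sum_condEntropy hw hf hf1).trans ?_
  simp only [Finset.mul_sum]
  refine Finset.sum_le_sum fun x _ => Finset.sum_le_sum fun η _ => ?_
  rw [mul_left_comm]
  refine mul_le_mul_of_nonneg_left ?_ (weight_pos hw η).le
  rw [condEntropy, condAvg_eq, condAvg_eq, ← neg_sub (√(f η)), neg_sq]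
  exact pair_entropy_le hε (siteWeight_mem_Icc (hu x) _).1 (siteWeight_mem_Icc (hu x) _).1
    (siteWeight_add_siteWeight_not _ _) (hf _) (hf _)

end Entropy

/-! ### The logarithmic Sobolev inequality -/

theorem sqrt_mul_le {r : ℝ} (hr : 1 ≤ r) (a : ℝ) : √(r * a) ≤ r * √a := by
  rw [Real.sqrt_mul (by linarith)]
  exact mul_le_mul_of_nonneg_right (Real.sqrt_le_self_iff.2 (Or.inr hr)) (Real.sqrt_nonneg a)

theorem sqrt_sum_mul_add_sq_le {ι : Type*} [Fintype ι] {w : ι → ℝ} (hw : ∀ i, 0 ≤ w i)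
    (f g : ι → ℝ) :
    √(∑ i, w i * (f i + g i) ^ 2) ≤ √(∑ i, w i * f i ^ 2) + √(∑ i, w i * g i ^ 2) := by
  have hnorm : ∀ F : ι → ℝ, √(∑ i, w i * F i ^ 2) =
      ‖(WithLp.toLp 2 fun i => √(w i) * F i : EuclideanSpace ℝ ι)‖ := fun F => by
    simp [EuclideanSpace.norm_eq, mul_pow, Real.sq_sqrt (hw _)]
  have hadd : (WithLp.toLp 2 fun i => √(w i) * (f i + g i) : EuclideanSpace ℝ ι) =
      WithLp.toLp 2 (fun i => √(w i) * f i) + WithLp.toLp 2 fun i => √(w i) * g i := by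
    ext i
    simp [mul_add]
  rw [hnorm, hnorm, hnorm, hadd]
  exact norm_add_le _ _

/-- The `L²` norm of the increment of `g` along a map `T` of configurations, with respect to the
Bernoulli product measure of density `u`. -/
def incNorm {n : ℕ} (u : Site n → ℝ) (g : Config n → ℝ) (T : Config n → Config n) : ℝ :=
  √(∑ η, weight u η * (g (T η) - g η) ^ 2)

/-- The Dirichlet form of the exclusion process with reservoirs of density `ρ`, with respect to
the Bernoulli product measure of density `u`. -/
def dirichlet (n : ℕ) (ρ : ℝ) (u : Site n → ℝ) (g : Config n → ℝ) : ℝ :=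
  (n : ℝ) ^ 2 * ∑ b ∈ bonds n, ∑ η, weight u η * (g (exchange b.1 b.2 η) - g η) ^ 2 +
    (n : ℝ) ^ 2 * ∑ x ∈ boundary n, ∑ η, weight u η * (rate ρ (η x) * (g (flip x η) - g η) ^ 2)

/-- A constant in the logarithmic Sobolev inequality for Bernoulli product measures whose densities
lie in `[ε, 1 - ε]` and vary by at most `K / n` between neighbours. The summand `1` only serves to
make it at least `1`. -/
def sobolevConst (ε K : ℝ) : ℝ :=
  1 + 2 / ε * (2 * Real.exp (K / ε ^ 2) ^ 2 * ((1 + K / ε ^ 2) / ε + 1) ^ 2 / ε)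

theorem one_le_sobolevConst {ε K : ℝ} (hε : 0 < ε) : 1 ≤ sobolevConst ε K := by
  rw [sobolevConst, le_add_iff_nonneg_right]
  positivity

section LogSobolev

variable {n : ℕ} {ε d K ρ : ℝ} {u : Site n → ℝ} {g : Config n → ℝ}

theorem flip_eq_exchange_flip_exchange (x y : Site n) (η : Config n) :
    flip y η = exchange x y (flip x (exchange x y η)) := by
  funext z
  rcases eq_or_ne z y with rfl | hzy
  · rw [flip_self, exchange_right, flip_self, exchange_left]
  · rcases eq_or_ne z x with rfl | hzx
    · rw [exchange_left, flip_of_ne hzy, flip_of_ne hzy.symm, exchange_right]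
    · rw [exchange_of_ne hzx hzy, flip_of_ne hzy, flip_of_ne hzx, exchange_of_ne hzx hzy]

theorem weight_nonneg (hε : 0 < ε) (hu : ∀ x, u x ∈ Icc ε (1 - ε)) (η : Config n) :
    0 ≤ weight u η := (weight_pos (fun x => siteWeight_pos hε (hu x)) η).le

theorem weight_exchange_le (hε : 0 < ε) (hu : ∀ x, u x ∈ Icc ε (1 - ε)) {x y : Site n}
    (hxy : x ≠ y) (hd : |u y - u x| ≤ d) (η : Config n) :
    weight u (exchange x y η) ≤ (1 + d / ε ^ 2) * weight u η := by
  have hx := (siteWeight_mem_Icc (hu x) (η x)).1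
  have hy := (siteWeight_mem_Icc (hu y) (η y)).1
  have hsite : siteWeight (u x) (η y) * siteWeight (u y) (η x) ≤
      siteWeight (u x) (η x) * siteWeight (u y) (η y) + d := by
    have := abs_le.1 hd
    cases η x <;> cases η y <;> simp only [siteWeight, occ] <;> norm_num <;> linarith
  have hprod : ε ^ 2 ≤ siteWeight (u x) (η x) * siteWeight (u y) (η y) := by
    rw [sq]
    exact mul_le_mul hx hy hε.le (hε.le.trans hx)
  have hdiv : d ≤ d / ε ^ 2 * (siteWeight (u x) (η x) * siteWeight (u y) (η y)) := by
    rw [div_mul_eq_mul_div, le_div_iff₀ (by positivity)]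
    exact mul_le_mul_of_nonneg_left hprod ((abs_nonneg _).trans hd)
  refine le_of_mul_le_mul_right ?_ ((by positivity : 0 < ε ^ 2).trans_le hprod)
  rw [weight_exchange u hxy, mul_comm (1 + d / ε ^ 2), mul_assoc]
  exact mul_le_mul_of_nonneg_left (by linarith) (weight_nonneg hε hu η)

theorem weight_flip_le (hε : 0 < ε) (hu : ∀ x, u x ∈ Icc ε (1 - ε)) (x : Site n) (η : Config n) :
    weight u (flip x η) ≤ 1 / ε * weight u η := by
  have hx := (siteWeight_mem_Icc (hu x) (η x)).1
  refine le_of_mul_le_mul_right ?_ (hε.trans_le hx)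
  rw [weight_flip, mul_comm (1 / ε), mul_assoc]
  refine mul_le_mul_of_nonneg_left ?_ (weight_nonneg hε hu η)
  rw [div_mul_eq_mul_div, le_div_iff₀ hε, one_mul]
  have := siteWeight_add_siteWeight_not (u x) (η x)
  nlinarith

theorem sum_weight_mul_comp_exchange_le (hε : 0 < ε) (hu : ∀ x, u x ∈ Icc ε (1 - ε)) {x y : Site n}
    (hxy : x ≠ y) (hd : |u y - u x| ≤ d) {h : Config n → ℝ} (hh : ∀ η, 0 ≤ h η) :
    ∑ η, weight u η * h (exchange x y η) ≤ (1 + d / ε ^ 2) * ∑ η, weight u η * h η := by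
  rw [← sum_comp_exchange x y, Finset.mul_sum]
  refine Finset.sum_le_sum fun η _ => ?_
  rw [exchange_involutive x y η, ← mul_assoc]
  exact mul_le_mul_of_nonneg_right (weight_exchange_le hε hu hxy hd η) (hh η)

theorem sum_weight_mul_comp_flip_le (hε : 0 < ε) (hu : ∀ x, u x ∈ Icc ε (1 - ε)) (x : Site n)
    {h : Config n → ℝ} (hh : ∀ η, 0 ≤ h η) :
    ∑ η, weight u η * h (flip x η) ≤ 1 / ε * ∑ η, weight u η * h η := by
  rw [← sum_comp_flip x, Finset.mul_sum]
  refine Finset.sum_le_sum fun η _ => ?_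
  rw [flip_involutive x η, ← mul_assoc]
  exact mul_le_mul_of_nonneg_right (weight_flip_le hε hu x η) (hh η)

theorem incNorm_nonneg (u : Site n → ℝ) (g : Config n → ℝ) (T : Config n → Config n) :
    0 ≤ incNorm u g T := Real.sqrt_nonneg _

theorem incNorm_sq (hε : 0 < ε) (hu : ∀ x, u x ∈ Icc ε (1 - ε)) (g : Config n → ℝ)
    (T : Config n → Config n) :
    incNorm u g T ^ 2 = ∑ η, weight u η * (g (T η) - g η) ^ 2 :=
  Real.sq_sqrt (Finset.sum_nonneg fun η _ => mul_nonneg (weight_nonneg hε hu η) (sq_nonneg _))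

theorem incNorm_flip_le (hε : 0 < ε) (hu : ∀ x, u x ∈ Icc ε (1 - ε)) {x y : Site n} (hxy : x ≠ y)
    (hd : |u y - u x| ≤ d) (g : Config n → ℝ) :
    incNorm u g (flip y) ≤ (1 + d / ε ^ 2) * incNorm u g (flip x) +
      ((1 + d / ε ^ 2) / ε + 1) * incNorm u g (exchange x y) := by
  have hq : 1 ≤ 1 + d / ε ^ 2 :=
    le_add_of_nonneg_right (div_nonneg ((abs_nonneg _).trans hd) (sq_nonneg ε))
  have hε1 : ε ≤ 1 := by linarith [(hu x).1, (hu x).2]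
  set q := 1 + d / ε ^ 2
  have hflip : √(∑ η, weight u η * (g (flip x (exchange x y η)) - g (exchange x y η)) ^ 2) ≤
      q * incNorm u g (flip x) :=
    (Real.sqrt_le_sqrt (sum_weight_mul_comp_exchange_le hε hu hxy hd
      (h := fun η => (g (flip x η) - g η) ^ 2) fun _ => sq_nonneg _)).trans (sqrt_mul_le hq _)
  have hexch : √(∑ η, weight u η * (g (exchange x y (flip x (exchange x y η))) -
      g (flip x (exchange x y η))) ^ 2) ≤ q / ε * incNorm u g (exchange x y) := by
    have h₁ := sum_weight_mul_comp_exchange_le hε hu hxy hd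
      (h := fun η => (g (exchange x y (flip x η)) - g (flip x η)) ^ 2) fun _ => sq_nonneg _
    have h₂ := sum_weight_mul_comp_flip_le hε hu x
      (h := fun η => (g (exchange x y η) - g η) ^ 2) fun _ => sq_nonneg _
    have h₃ := h₁.trans (mul_le_mul_of_nonneg_left h₂ (zero_le_one.trans hq))
    rw [← mul_assoc, mul_one_div] at h₃
    exact (Real.sqrt_le_sqrt h₃).trans
      (sqrt_mul_le ((one_le_div₀ hε).2 (hε1.trans hq)) _)
  have hsplit : incNorm u g (flip y) = √(∑ η, weight u η *
      (((g (exchange x y (flip x (exchange x y η))) - g (flip x (exchange x y η))) +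
        (g (flip x (exchange x y η)) - g (exchange x y η))) +
        (g (exchange x y η) - g η)) ^ 2) := by
    simp only [incNorm, flip_eq_exchange_flip_exchange x y, sub_add_sub_cancel]
  have htri := sqrt_sum_mul_add_sq_le (weight_nonneg hε hu)
  rw [hsplit]
  calc _ ≤ q / ε * incNorm u g (exchange x y) + q * incNorm u g (flip x) +
        incNorm u g (exchange x y) :=
      (htri _ _).trans (add_le_add_left ((htri _ _).trans (add_le_add hexch hflip)) _)
    _ = _ := by ring

theorem sum_filter_bonds_add_le {G : Site n × Site n → ℝ} (hG : ∀ b, 0 ≤ G b) {k : ℕ}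
    {b : Site n × Site n} (hb : b ∈ bonds n) (hbk : b.2.1 = k + 1) :
    (∑ c ∈ bonds n with c.2.1 ≤ k, G c) + G b ≤ ∑ c ∈ bonds n with c.2.1 ≤ k + 1, G c := by
  rw [add_comm, ← Finset.sum_insert fun h => by simp [hbk] at h]
  refine Finset.sum_le_sum_of_subset_of_nonneg (fun c hc => ?_) fun c _ _ => hG c
  rcases Finset.mem_insert.1 hc with rfl | hc
  · exact Finset.mem_filter.2 ⟨hb, hbk.le⟩
  · rw [Finset.mem_filter] at hc ⊢
    exact ⟨hc.1, by omega⟩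

theorem incNorm_flip_le_path (hε : 0 < ε) (hu : ∀ x, u x ∈ Icc ε (1 - ε)) (hd : 0 ≤ d)
    (hgrad : ∀ b ∈ bonds n, |u b.2 - u b.1| ≤ d) (g : Config n → ℝ) {x₁ : Site n}
    (hx₁ : x₁.1 = 1) (k : ℕ) : ∀ x : Site n, x.1 = k + 1 →
    incNorm u g (flip x) ≤ (1 + d / ε ^ 2) ^ k * (incNorm u g (flip x₁) +
      ((1 + d / ε ^ 2) / ε + 1) *
        ∑ b ∈ bonds n with b.2.1 ≤ k + 1, incNorm u g (exchange b.1 b.2)) := by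
  have hq : 1 ≤ 1 + d / ε ^ 2 := le_add_of_nonneg_right (by positivity)
  set q := 1 + d / ε ^ 2
  have hB : 0 ≤ q / ε + 1 := by positivity
  induction k with
  | zero =>
    intro x hx
    obtain rfl : x = x₁ := Subtype.ext (hx.trans hx₁.symm)
    rw [pow_zero, one_mul]
    exact le_add_of_nonneg_right
      (mul_nonneg hB (Finset.sum_nonneg fun b _ => incNorm_nonneg _ _ _))
  | succ k ih =>
    intro x hx
    have hxn := (Finset.mem_Ioo.1 x.2).2
    let y : Site n := ⟨k + 1, Finset.mem_Ioo.2 (by omega)⟩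
    have hyx : (y, x) ∈ bonds n := mem_bonds.2 hx
    calc incNorm u g (flip x)
        ≤ q * incNorm u g (flip y) + (q / ε + 1) * incNorm u g (exchange y x) :=
          incNorm_flip_le hε hu (ne_of_mem_bonds hyx) (hgrad _ hyx) g
      _ ≤ q * (q ^ k * (incNorm u g (flip x₁) + (q / ε + 1) *
            ∑ b ∈ bonds n with b.2.1 ≤ k + 1, incNorm u g (exchange b.1 b.2))) +
          q ^ (k + 1) * ((q / ε + 1) * incNorm u g (exchange y x)) := by
        refine add_le_add (mul_le_mul_of_nonneg_left (ih y rfl) (zero_le_one.trans hq)) ?_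
        exact le_mul_of_one_le_left (mul_nonneg hB (incNorm_nonneg _ _ _)) (one_le_pow₀ hq)
      _ = q ^ (k + 1) * (incNorm u g (flip x₁) + (q / ε + 1) *
            ((∑ b ∈ bonds n with b.2.1 ≤ k + 1, incNorm u g (exchange b.1 b.2)) +
              incNorm u g (exchange y x))) := by ring
      _ ≤ _ := mul_le_mul_of_nonneg_left (add_le_add_right (mul_le_mul_of_nonneg_left
          (sum_filter_bonds_add_le (fun _ => incNorm_nonneg _ _ _) hyx hx) hB) _) (by positivity)

theorem one_add_div_pow_le_exp {a : ℝ} (ha : 0 ≤ a) {k m : ℕ} (hkm : k ≤ m) (hm : 0 < m) :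
    (1 + a / m) ^ k ≤ Real.exp a := by
  have hm' : (m : ℝ) ≠ 0 := by exact_mod_cast hm.ne'
  calc (1 + a / m) ^ k ≤ (1 + a / m) ^ m :=
        pow_le_pow_right₀ (le_add_of_nonneg_right (by positivity)) hkm
    _ ≤ Real.exp (a / m) ^ m := by
        gcongr
        linarith [Real.add_one_le_exp (a / m)]
    _ = Real.exp a := by rw [← Real.exp_nat_mul, mul_div_cancel₀ _ hm']

theorem incNorm_flip_le_sum (hε : 0 < ε) (hK : 0 ≤ K) (hu : ∀ x, u x ∈ Icc ε (1 - ε))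
    (hgrad : ∀ b ∈ bonds n, |u b.2 - u b.1| ≤ K / n) (g : Config n → ℝ) {x₁ : Site n}
    (hx₁ : x₁.1 = 1) (x : Site n) :
    incNorm u g (flip x) ≤ Real.exp (K / ε ^ 2) * (incNorm u g (flip x₁) +
      ((1 + K / ε ^ 2) / ε + 1) * ∑ b ∈ bonds n, incNorm u g (exchange b.1 b.2)) := by
  have hx := Finset.mem_Ioo.1 x.2
  have hn1 : (1 : ℝ) ≤ n := by exact_mod_cast (by omega : 1 ≤ n)
  have hq : (1 + K / n / ε ^ 2) / ε + 1 ≤ (1 + K / ε ^ 2) / ε + 1 := by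
    gcongr
    exact div_le_self hK hn1
  have hpow : (1 + K / n / ε ^ 2) ^ (x.1 - 1) ≤ Real.exp (K / ε ^ 2) := by
    rw [div_right_comm]
    exact one_add_div_pow_le_exp (by positivity) (by omega) (by omega)
  have hsub : ∑ b ∈ bonds n with b.2.1 ≤ x.1 - 1 + 1, incNorm u g (exchange b.1 b.2) ≤
      ∑ b ∈ bonds n, incNorm u g (exchange b.1 b.2) :=
    Finset.sum_le_sum_of_subset_of_nonneg (Finset.filter_subset _ _) fun b _ _ =>
      incNorm_nonneg _ _ _
  have hfilter0 : 0 ≤ ∑ b ∈ bonds n with b.2.1 ≤ x.1 - 1 + 1, incNorm u g (exchange b.1 b.2) :=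
    Finset.sum_nonneg fun b _ => incNorm_nonneg _ _ _
  refine (incNorm_flip_le_path hε hu (by positivity) hgrad g hx₁ (x.1 - 1) x
    (by omega)).trans (mul_le_mul hpow ?_ ?_ (Real.exp_pos _).le)
  · exact add_le_add_right (mul_le_mul hq hsub hfilter0 (by positivity)) _
  · exact add_nonneg (incNorm_nonneg _ _ _) (mul_nonneg (by positivity) hfilter0)

theorem incNorm_flip_sq_le (hε : 0 < ε) (hK : 0 ≤ K) (hu : ∀ x, u x ∈ Icc ε (1 - ε))
    (hgrad : ∀ b ∈ bonds n, |u b.2 - u b.1| ≤ K / n) (g : Config n → ℝ) {x₁ : Site n}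
    (hx₁ : x₁.1 = 1) (x : Site n) :
    incNorm u g (flip x) ^ 2 ≤ 2 * Real.exp (K / ε ^ 2) ^ 2 * ((1 + K / ε ^ 2) / ε + 1) ^ 2 * n *
      (incNorm u g (flip x₁) ^ 2 + ∑ b ∈ bonds n, incNorm u g (exchange b.1 b.2) ^ 2) := by
  have hx := Finset.mem_Ioo.1 x.2
  have hn1 : (1 : ℝ) ≤ n := by exact_mod_cast (by omega : 1 ≤ n)
  have hlin := incNorm_flip_le_sum hε hK hu hgrad g hx₁ x
  have hB1 : 1 ≤ (1 + K / ε ^ 2) / ε + 1 := le_add_of_nonneg_left (by positivity)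
  set B := (1 + K / ε ^ 2) / ε + 1
  set Q := Real.exp (K / ε ^ 2)
  set s := ∑ b ∈ bonds n, incNorm u g (exchange b.1 b.2)
  set a := incNorm u g (flip x₁)
  have hcauchy : s ^ 2 ≤ n * ∑ b ∈ bonds n, incNorm u g (exchange b.1 b.2) ^ 2 := by
    refine sq_sum_le_card_mul_sum_sq.trans
      (mul_le_mul_of_nonneg_right ?_ (Finset.sum_nonneg fun b _ => sq_nonneg _))
    exact_mod_cast card_bonds_le n
  have hBn : 1 ≤ B ^ 2 * n := one_le_mul_of_one_le_of_one_le (one_le_pow₀ hB1) hn1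
  calc incNorm u g (flip x) ^ 2 ≤ (Q * (a + B * s)) ^ 2 :=
        pow_le_pow_left₀ (incNorm_nonneg _ _ _) hlin 2
    _ ≤ Q ^ 2 * (2 * (a ^ 2 + (B * s) ^ 2)) := by
        rw [mul_pow]
        gcongr
        exact add_sq_le
    _ ≤ Q ^ 2 * (2 * (B ^ 2 * n * a ^ 2 +
          B ^ 2 * (n * ∑ b ∈ bonds n, incNorm u g (exchange b.1 b.2) ^ 2))) := by
        rw [mul_pow B s]
        gcongr
        exact le_mul_of_one_le_left (sq_nonneg a) hBn
    _ = _ := by ring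

theorem dirichlet_nonneg (hε : 0 < ε) (hρ : ρ ∈ Icc ε (1 - ε)) (hu : ∀ x, u x ∈ Icc ε (1 - ε))
    (g : Config n → ℝ) : 0 ≤ dirichlet n ρ u g := by
  have hw := weight_nonneg hε hu
  have hrate : ∀ b, 0 ≤ rate ρ b := fun b => hε.le.trans (rate_mem_Icc hρ b).1
  exact add_nonneg
    (mul_nonneg (sq_nonneg _) (Finset.sum_nonneg fun b _ => Finset.sum_nonneg fun η _ =>
      mul_nonneg (hw η) (sq_nonneg _)))
    (mul_nonneg (sq_nonneg _) (Finset.sum_nonneg fun x _ => Finset.sum_nonneg fun η _ =>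
      mul_nonneg (hw η) (mul_nonneg (hrate _) (sq_nonneg _))))

theorem mul_sum_incNorm_sq_le_dirichlet (hε : 0 < ε) (hρ : ρ ∈ Icc ε (1 - ε))
    (hu : ∀ x, u x ∈ Icc ε (1 - ε)) (g : Config n → ℝ) {x₁ : Site n} (hx₁ : x₁.1 = 1) :
    (n : ℝ) ^ 2 * (ε * (incNorm u g (flip x₁) ^ 2 +
      ∑ b ∈ bonds n, incNorm u g (exchange b.1 b.2) ^ 2)) ≤ dirichlet n ρ u g := by
  have hε1 : ε ≤ 1 := by linarith [hρ.1, hρ.2]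
  have hw := weight_nonneg hε hu
  have hflip : ε * incNorm u g (flip x₁) ^ 2 ≤
      ∑ x ∈ boundary n, ∑ η, weight u η * (rate ρ (η x) * (g (flip x η) - g η) ^ 2) := by
    calc _ = ∑ η, weight u η * (ε * (g (flip x₁ η) - g η) ^ 2) := by
          rw [incNorm_sq hε hu, Finset.mul_sum]
          exact Finset.sum_congr rfl fun η _ => by ring
      _ ≤ ∑ η, weight u η * (rate ρ (η x₁) * (g (flip x₁ η) - g η) ^ 2) := by
          gcongr with η
          exacts [hw η, (rate_mem_Icc hρ _).1]
      _ ≤ _ := Finset.single_le_sum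
          (f := fun x => ∑ η, weight u η * (rate ρ (η x) * (g (flip x η) - g η) ^ 2))
          (fun x _ => Finset.sum_nonneg fun η _ => mul_nonneg (hw η)
            (mul_nonneg (hε.le.trans (rate_mem_Icc hρ _).1) (sq_nonneg _)))
          (mem_boundary.2 (Or.inl hx₁))
  have hexch : ε * ∑ b ∈ bonds n, incNorm u g (exchange b.1 b.2) ^ 2 ≤
      ∑ b ∈ bonds n, ∑ η, weight u η * (g (exchange b.1 b.2 η) - g η) ^ 2 := by
    simp only [← incNorm_sq hε hu]
    exact mul_le_of_le_one_left (Finset.sum_nonneg fun b _ => sq_nonneg _) hε1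
  rw [dirichlet, ← mul_add]
  gcongr
  linarith

theorem sum_flip_le_dirichlet (hε : 0 < ε) (hK : 0 ≤ K) (hρ : ρ ∈ Icc ε (1 - ε))
    (hu : ∀ x, u x ∈ Icc ε (1 - ε)) (hgrad : ∀ b ∈ bonds n, |u b.2 - u b.1| ≤ K / n)
    (g : Config n → ℝ) :
    ∑ x, ∑ η, weight u η * (g (flip x η) - g η) ^ 2 ≤
      2 * Real.exp (K / ε ^ 2) ^ 2 * ((1 + K / ε ^ 2) / ε + 1) ^ 2 / ε * dirichlet n ρ u g := by
  rcases isEmpty_or_nonempty (Site n) with _ | ⟨⟨x, hx⟩⟩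
  · rw [Finset.univ_eq_empty, Finset.sum_empty]
    exact mul_nonneg (by positivity) (dirichlet_nonneg hε hρ hu g)
  let x₁ : Site n := ⟨1, by rw [Finset.mem_Ioo] at hx ⊢; omega⟩
  have hcard : ((Finset.univ : Finset (Site n)).card : ℝ) ≤ n := by
    exact_mod_cast (by simp : (Finset.univ : Finset (Site n)).card ≤ n)
  set S := incNorm u g (flip x₁) ^ 2 + ∑ b ∈ bonds n, incNorm u g (exchange b.1 b.2) ^ 2
  set c := 2 * Real.exp (K / ε ^ 2) ^ 2 * ((1 + K / ε ^ 2) / ε + 1) ^ 2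
  calc ∑ x, ∑ η, weight u η * (g (flip x η) - g η) ^ 2
      = ∑ x, incNorm u g (flip x) ^ 2 := by simp only [incNorm_sq hε hu]
    _ ≤ ∑ _x : Site n, c * n * S :=
        Finset.sum_le_sum fun x _ => incNorm_flip_sq_le hε hK hu hgrad g rfl x
    _ ≤ n * (c * n * S) := by
        rw [Finset.sum_const, nsmul_eq_mul]
        gcongr
    _ = c / ε * ((n : ℝ) ^ 2 * (ε * S)) := by field_simp
    _ ≤ c / ε * dirichlet n ρ u g := by
        gcongr
        exact mul_sum_incNorm_sq_le_dirichlet hε hρ hu g rfl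

theorem sum_weight_mul_log_le_dirichlet (hε : 0 < ε) (hK : 0 ≤ K) (hρ : ρ ∈ Icc ε (1 - ε))
    (hu : ∀ x, u x ∈ Icc ε (1 - ε)) (hgrad : ∀ b ∈ bonds n, |u b.2 - u b.1| ≤ K / n)
    {f : Config n → ℝ} (hf : ∀ η, 0 < f η) (hf1 : ∑ η, weight u η * f η = 1) :
    ∑ η, weight u η * (f η * Real.log (f η)) ≤
      sobolevConst ε K * dirichlet n ρ u fun η => √(f η) := by
  calc _ ≤ 2 / ε * ∑ x, ∑ η, weight u η * (√(f (flip x η)) - √(f η)) ^ 2 :=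
        sum_weight_mul_log_le_sum_flip hε hu hf hf1
    _ ≤ (sobolevConst ε K - 1) * dirichlet n ρ u fun η => √(f η) := by
        rw [sobolevConst, add_sub_cancel_left, mul_assoc (2 / ε)]
        exact mul_le_mul_of_nonneg_left
          (sum_flip_le_dirichlet hε hK hρ hu hgrad fun η => √(f η)) (div_pos two_pos hε).le
    _ ≤ _ := mul_le_mul_of_nonneg_right (sub_le_self _ zero_le_one) (dirichlet_nonneg hε hρ hu _)

end LogSobolev

/-! ### The discrete heat equation -/

section HeatEquation

variable {n : ℕ} {U : ℝ → ℕ → ℝ}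

theorem le_of_hasDerivAt_discreteLaplacian {M : ℝ}
    (hU : ∀ t, 0 ≤ t → ∀ k ∈ Finset.Ioo 0 n,
      HasDerivAt (fun s => U s k) (discreteLaplacian n (U t) k) t)
    (hb : ∀ t, 0 ≤ t → ∀ k, k ∉ Finset.Ioo 0 n → U t k ≤ M) (h0 : ∀ k, U 0 k ≤ M)
    {t : ℝ} (ht : 0 ≤ t) (k : ℕ) : U t k ≤ M := by
  by_cases hk : k ∈ Finset.Ioo 0 n
  · refine sub_nonpos.1 (nonpos_of_deriv_nonpos_at_max (w := fun t k => U t k - M)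
      (fun t ht k hk => (hU t ht k hk).sub_const M) (fun k _ => sub_nonpos.2 (h0 k))
      (fun t ht k _ hpos hmax => ?_) ht hk)
    have hle : ∀ j, U t j ≤ U t k := fun j => by
      by_cases hj : j ∈ Finset.Ioo 0 n
      · exact (sub_le_sub_iff_right M).1 (hmax j hj)
      · exact (hb t ht j hj).trans (sub_pos.1 hpos).le
    exact mul_nonpos_of_nonneg_of_nonpos (sq_nonneg _) (by linarith [hle (k + 1), hle (k - 1)])
  · exact hb t ht k hk

theorem reflectedLaplacian_forward_sub (f : ℕ → ℝ) {k : ℕ} (hk : k < n) :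
    reflectedLaplacian n (fun j => f (j + 1) - f j) k =
      (if k + 1 ∈ Finset.Ioo 0 n then discreteLaplacian n f (k + 1) else 0) -
        if k ∈ Finset.Ioo 0 n then discreteLaplacian n f k else 0 := by
  simp only [reflectedLaplacian, discreteLaplacian, Finset.mem_Ioo, hk, k.succ_pos, true_and,
    and_true, Nat.add_sub_cancel]
  rcases k.eq_zero_or_pos with rfl | hk0
  · simp only [lt_irrefl, if_false]
    split_ifs <;> ring
  · rw [if_pos hk0, if_pos hk0, Nat.sub_add_cancel hk0]
    split_ifs <;> ring

-- The increments of a solution with constant boundary values solve a reflected heat equation.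
theorem abs_sub_le_of_hasDerivAt_discreteLaplacian {A ρ : ℝ} (hA : 0 ≤ A)
    (hU : ∀ t, 0 ≤ t → ∀ k ∈ Finset.Ioo 0 n,
      HasDerivAt (fun s => U s k) (discreteLaplacian n (U t) k) t)
    (hb : ∀ t k, k ∉ Finset.Ioo 0 n → U t k = ρ) (h0 : ∀ k < n, |U 0 (k + 1) - U 0 k| ≤ A)
    {t : ℝ} (ht : 0 ≤ t) {k : ℕ} (hk : k < n) :
    |U t (k + 1) - U t k| ≤ 4 * A * Real.exp (-2 * t) := by
  have hd : ∀ s, 0 ≤ s → ∀ j, HasDerivAt (fun s => U s j)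
      (if j ∈ Finset.Ioo 0 n then discreteLaplacian n (U s) j else 0) s := fun s hs j => by
    split_ifs with hj
    · exact hU s hs j hj
    · simpa only [hb _ j hj] using hasDerivAt_const s ρ
  refine abs_le_of_hasDerivAt_reflectedLaplacian (v := fun t k => U t (k + 1) - U t k) hA
    (fun s hs j hj => ?_) h0 ht ?_ hk
  · rw [reflectedLaplacian_forward_sub (U s) hj]
    exact (hd s hs (j + 1)).sub (hd s hs j)
  · rw [Finset.sum_range_sub, hb t 0 (by simp), hb t n (by simp), sub_self]

end HeatEquation

/-! ### The equation of the two-point correlations -/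

/-- The discrete Laplacian in the diffusive time scale for two indistinguishable exclusion
particles at `z < w`: when they are adjacent, the two moves onto each other are suppressed. -/
def pairLaplacian (n : ℕ) (c : ℕ × ℕ → ℝ) (q : ℕ × ℕ) : ℝ :=
  (n : ℝ) ^ 2 * (c (q.1 - 1, q.2) + c (q.1, q.2 + 1) - 2 * c q +
    if q.2 = q.1 + 1 then 0 else c (q.1 + 1, q.2) + c (q.1, q.2 - 1) - 2 * c q)

section PairLaplacian

variable {n : ℕ}

theorem pairLaplacian_nonpos_at_max {c : ℕ × ℕ → ℝ} {k l : ℕ} (hkl : k < l) (hl : l < n)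
    (hmax : ∀ i j, i < j → j ≤ n → c (i, j) ≤ c (k, l)) : pairLaplacian n c (k, l) ≤ 0 := by
  refine mul_nonpos_of_nonneg_of_nonpos (sq_nonneg _) ?_
  have hleft := hmax (k - 1) l (by omega) hl.le
  have hright := hmax k (l + 1) (by omega) hl
  split_ifs with hadj
  · linarith
  · have hadj' : l ≠ k + 1 := hadj
    have hup := hmax (k + 1) l (by omega) hl.le
    have hdown := hmax k (l - 1) (by omega) (by omega)
    dsimp only
    linarith

theorem pairLaplacian_neg_sub_mul (c ψ : ℕ × ℕ → ℝ) (m : ℝ) (q : ℕ × ℕ) :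
    pairLaplacian n (fun q => -c q - m * ψ q) q =
      -pairLaplacian n c q - m * pairLaplacian n ψ q := by
  unfold pairLaplacian
  split_ifs <;> ring

theorem pairLaplacian_mul_sub {k l : ℕ} (hk : 0 < k) (hkl : k < l) :
    pairLaplacian n (fun q => q.1 * (n - q.2)) (k, l) =
      if l = k + 1 then -(n : ℝ) ^ 2 * (n - 1) else 0 := by
  have hk' : ((k - 1 : ℕ) : ℝ) = k - 1 := Nat.cast_pred hk
  have hl' : ((l - 1 : ℕ) : ℝ) = l - 1 := Nat.cast_pred (hk.trans hkl)
  simp only [pairLaplacian, hk', hl', Nat.cast_add, Nat.cast_one]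
  split_ifs with hadj
  · subst hadj
    push_cast
    ring
  · ring

theorem neg_pairLaplacian_sub_le_at_max {c : ℕ × ℕ → ℝ} {m γ : ℝ} (hm : 0 ≤ m)
    (hγ : γ ≤ m * (n - 1)) (hleft : ∀ w, c (0, w) = 0) (hright : ∀ z, c (z, n) = 0) {k l : ℕ}
    (hk : 0 < k) (hkl : k < l) (hl : l < n) (hpos : 0 < -c (k, l) - m * (k * (n - l)))
    (hmax : ∀ i j, 0 < i → i < j → j < n →
      -c (i, j) - m * (i * (n - j)) ≤ -c (k, l) - m * (k * (n - l))) :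
    -(pairLaplacian n c (k, l) - if l = k + 1 then (n : ℝ) ^ 2 * γ else 0) ≤ 0 := by
  have hlap := pairLaplacian_nonpos_at_max (c := fun q => -c q - m * (q.1 * (n - q.2))) hkl hl
    fun i j hij hj => by
      by_cases hq : 0 < i ∧ j < n
      · exact hmax i j hq.1 hij hq.2
      · have hzero : c (i, j) = 0 := by
          obtain rfl | rfl : i = 0 ∨ j = n := by omega
          exacts [hleft j, hright i]
        have : 0 ≤ m * (i * ((n : ℝ) - j)) :=
          mul_nonneg hm (mul_nonneg i.cast_nonneg (sub_nonneg.2 (by exact_mod_cast hj)))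
        linarith
  rw [pairLaplacian_neg_sub_mul c fun q => q.1 * (n - q.2), pairLaplacian_mul_sub hk hkl] at hlap
  have hsource := mul_le_mul_of_nonneg_left hγ (sq_nonneg (n : ℝ))
  split_ifs at hlap ⊢ <;> linarith

-- The barrier is a multiple of the Green function `z (n - w)` of the source on the diagonal.
theorem neg_le_of_hasDerivAt_pairLaplacian (hn : 2 ≤ n) {G : ℝ} (hG : 0 ≤ G)
    {c : ℝ → ℕ × ℕ → ℝ} {g : ℝ → ℕ → ℝ}
    (hc : ∀ t, 0 ≤ t → ∀ z w, 0 < z → z < w → w < n → HasDerivAt (fun s => c s (z, w))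
      (pairLaplacian n (c t) (z, w) - if w = z + 1 then (n : ℝ) ^ 2 * g t z else 0) t)
    (hleft : ∀ t w, c t (0, w) = 0) (hright : ∀ t z, c t (z, n) = 0)
    (hg : ∀ t, 0 ≤ t → ∀ k < n, g t k ≤ G)
    (h0 : ∀ z w, 0 < z → z < w → w < n → 0 ≤ c 0 (z, w)) {t : ℝ} (ht : 0 ≤ t) {z w : ℕ}
    (hz : 0 < z) (hzw : z < w) (hw : w < n) :
    -c t (z, w) ≤ 2 * G / n * (z * (n - w)) := by
  set m := 2 * G / n with hm
  have hm0 : 0 ≤ m := by positivity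
  have hmG : G ≤ m * (n - 1) := by
    have hn2 : (2 : ℝ) ≤ n := by exact_mod_cast hn
    rw [hm, div_mul_eq_mul_div, le_div_iff₀ (by linarith)]
    nlinarith
  set S : Finset (ℕ × ℕ) :=
    (Finset.range n ×ˢ Finset.range n).filter fun q => 0 < q.1 ∧ q.1 < q.2 with hS
  have hmem : ∀ k l, (k, l) ∈ S ↔ 0 < k ∧ k < l ∧ l < n := fun k l => by
    simp only [hS, Finset.mem_filter, Finset.mem_product, Finset.mem_range]
    omega
  refine sub_nonpos.1 (nonpos_of_deriv_nonpos_at_max (S := S)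
    (w := fun t q => -c t q - m * (q.1 * (n - q.2)))
    (w' := fun t q => -(pairLaplacian n (c t) q -
      if q.2 = q.1 + 1 then (n : ℝ) ^ 2 * g t q.1 else 0)) ?_ ?_ ?_ ht ((hmem z w).2 ⟨hz, hzw, hw⟩))
  · rintro s hs ⟨k, l⟩ hq
    obtain ⟨hk, hkl, hl⟩ := (hmem k l).1 hq
    exact (hc s hs k l hk hkl hl).neg.sub_const _
  · rintro ⟨k, l⟩ hq
    obtain ⟨hk, hkl, hl⟩ := (hmem k l).1 hq
    have : 0 ≤ m * (k * ((n : ℝ) - l)) :=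
      mul_nonneg hm0 (mul_nonneg k.cast_nonneg (sub_nonneg.2 (by exact_mod_cast hl.le)))
    linarith [h0 k l hk hkl hl]
  · rintro s hs ⟨k, l⟩ hq hpos hmax
    obtain ⟨hk, hkl, hl⟩ := (hmem k l).1 hq
    exact neg_pairLaplacian_sub_le_at_max hm0 ((hg s hs k (hkl.trans hl)).trans hmG) (hleft s)
      (hright s) hk hkl hl hpos fun i j hi hij hj => hmax (i, j) ((hmem i j).2 ⟨hi, hij, hj⟩)

end PairLaplacian

/-! ### Solutions of the forward equation -/

/-- `p` solves the forward (Kolmogorov) equation of the exclusion process, tested against all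
observables, and is a probability vector at nonnegative times. -/
structure IsForwardSolution (n : ℕ) (ρ : ℝ) (p : ℝ → Config n → ℝ) : Prop where
  hasDerivAt : ∀ (f : Config n → ℝ) (t : ℝ),
    HasDerivAt (fun s => ∑ η, p s η * f η) (∑ η, p t η * generator n ρ f η) t
  nonneg : ∀ t, 0 ≤ t → ∀ η, 0 ≤ p t η
  sum_eq_one : ∀ t, ∑ η, p t η = 1

/-- The density profile of `p`, extended by `ρ` outside the bulk. -/
def profile {n : ℕ} (ρ : ℝ) (p : ℝ → Config n → ℝ) (t : ℝ) (k : ℕ) : ℝ :=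
  ∑ η, p t η * extOcc ρ η k

/-- The expectation under `p` of the product of two occupation numbers, extended by `ρ` outside
the bulk. -/
def pairMean {n : ℕ} (ρ : ℝ) (p : ℝ → Config n → ℝ) (t : ℝ) (j k : ℕ) : ℝ :=
  ∑ η, p t η * (extOcc ρ η j * extOcc ρ η k)

/-- The two-point correlation function of `p`. -/
def corr {n : ℕ} (ρ : ℝ) (p : ℝ → Config n → ℝ) (t : ℝ) (q : ℕ × ℕ) : ℝ :=
  pairMean ρ p t q.1 q.2 - profile ρ p t q.1 * profile ρ p t q.2

section PairMean

variable {n : ℕ} {ρ : ℝ} {p : ℝ → Config n → ℝ} {t : ℝ}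

theorem pairMean_comm (j k : ℕ) : pairMean ρ p t j k = pairMean ρ p t k j :=
  Finset.sum_congr rfl fun η _ => by rw [mul_comm (extOcc ρ η j)]

theorem pairMean_self {k : ℕ} (hk : k ∈ Finset.Ioo 0 n) :
    pairMean ρ p t k k = profile ρ p t k :=
  Finset.sum_congr rfl fun η _ => by rw [extOcc_site ρ η ⟨k, hk⟩, occ_mul_self]

theorem pairMean_of_notMem {j : ℕ} (hj : j ∉ Finset.Ioo 0 n) (k : ℕ) :
    pairMean ρ p t j k = ρ * profile ρ p t k := by
  rw [profile, Finset.mul_sum]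
  exact Finset.sum_congr rfl fun η _ => by rw [extOcc_of_notMem ρ η hj, mul_left_comm]

theorem corr_comm (j k : ℕ) : corr ρ p t (j, k) = corr ρ p t (k, j) :=
  congrArg₂ (· - ·) (pairMean_comm j k) (mul_comm _ _)

theorem sum_mul_extOcc_mul_discreteLaplacian (j k : ℕ) :
    ∑ η, p t η * (extOcc ρ η j * discreteLaplacian n (extOcc ρ η) k) =
      discreteLaplacian n (pairMean ρ p t j) k := by
  unfold discreteLaplacian pairMean
  rw [Finset.mul_sum (a := (2 : ℝ)), ← Finset.sum_add_distrib, ← Finset.sum_sub_distrib,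
    Finset.mul_sum]
  exact Finset.sum_congr rfl fun η _ => by ring

theorem sum_mul_sq_extOcc_sub {j k : ℕ} (hj : j ∈ Finset.Ioo 0 n) (hk : k ∈ Finset.Ioo 0 n) :
    ∑ η, p t η * (extOcc ρ η j - extOcc ρ η k) ^ 2 =
      profile ρ p t j + profile ρ p t k - 2 * pairMean ρ p t j k := by
  rw [← pairMean_self hj, ← pairMean_self hk]
  unfold pairMean
  rw [Finset.mul_sum, ← Finset.sum_add_distrib, ← Finset.sum_sub_distrib]
  exact Finset.sum_congr rfl fun η _ => by ring

end PairMean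

namespace IsForwardSolution

variable {n : ℕ} {ρ : ℝ} {p : ℝ → Config n → ℝ}

theorem profile_of_notMem (hp : IsForwardSolution n ρ p) (t : ℝ) {k : ℕ}
    (hk : k ∉ Finset.Ioo 0 n) : profile ρ p t k = ρ := by
  simp only [profile, extOcc_of_notMem ρ _ hk, ← Finset.sum_mul, hp.sum_eq_one, one_mul]

theorem hasDerivAt_profile (hp : IsForwardSolution n ρ p) (hn : 3 ≤ n) (t : ℝ) {k : ℕ}
    (hk : k ∈ Finset.Ioo 0 n) :
    HasDerivAt (fun s => profile ρ p s k) (discreteLaplacian n (profile ρ p t) k) t := by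
  have h := hp.hasDerivAt (fun η => occ (η ⟨k, hk⟩)) t
  simp only [generator_occ hn] at h
  simp only [← extOcc_site ρ] at h
  refine h.congr_deriv ?_
  unfold discreteLaplacian profile
  rw [Finset.mul_sum (a := (2 : ℝ)), ← Finset.sum_add_distrib, ← Finset.sum_sub_distrib,
    Finset.mul_sum]
  exact Finset.sum_congr rfl fun η _ => by ring

theorem profile_mem_Icc (hp : IsForwardSolution n ρ p) (hn : 3 ≤ n) {a b : ℝ}
    (h0 : ∀ k, profile ρ p 0 k ∈ Icc a b) {t : ℝ} (ht : 0 ≤ t) (k : ℕ) :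
    profile ρ p t k ∈ Icc a b := by
  have hboundary : ∀ t, ∀ k ∉ Finset.Ioo 0 n, profile ρ p t k ∈ Icc a b := fun t k hk => by
    rw [hp.profile_of_notMem t hk, ← hp.profile_of_notMem 0 hk]
    exact h0 k
  constructor
  · refine neg_le_neg_iff.1 (le_of_hasDerivAt_discreteLaplacian (n := n)
      (U := fun t k => -profile ρ p t k) (fun t _ k hk => ?_)
      (fun t _ k hk => neg_le_neg (hboundary t k hk).1) (fun k => neg_le_neg (h0 k).1) ht k)
    refine (hp.hasDerivAt_profile hn t hk).neg.congr_deriv ?_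
    simp only [discreteLaplacian]
    ring
  · exact le_of_hasDerivAt_discreteLaplacian (n := n)
      (fun t _ k hk => hp.hasDerivAt_profile hn t hk) (fun t _ k hk => (hboundary t k hk).2)
      (fun k => (h0 k).2) ht k

theorem abs_profile_sub_le (hp : IsForwardSolution n ρ p) (hn : 3 ≤ n) {A : ℝ} (hA : 0 ≤ A)
    (h0 : ∀ k < n, |profile ρ p 0 (k + 1) - profile ρ p 0 k| ≤ A) {t : ℝ} (ht : 0 ≤ t)
    {k : ℕ} (hk : k < n) :
    |profile ρ p t (k + 1) - profile ρ p t k| ≤ 4 * A * Real.exp (-2 * t) :=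
  abs_sub_le_of_hasDerivAt_discreteLaplacian hA (fun t _ _ hk => hp.hasDerivAt_profile hn t hk)
    (fun t _ hk => hp.profile_of_notMem t hk) h0 ht hk

theorem corr_of_notMem (hp : IsForwardSolution n ρ p) (t : ℝ) {j : ℕ} (hj : j ∉ Finset.Ioo 0 n)
    (k : ℕ) : corr ρ p t (j, k) = 0 := by
  rw [corr, pairMean_of_notMem hj, hp.profile_of_notMem t hj, sub_self]

theorem hasDerivAt_pairMean (hp : IsForwardSolution n ρ p) (hn : 3 ≤ n) (t : ℝ) {z w : ℕ}
    (hz : z ∈ Finset.Ioo 0 n) (hw : w ∈ Finset.Ioo 0 n) (hzw : z < w) :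
    HasDerivAt (fun s => pairMean ρ p s z w)
      (discreteLaplacian n (pairMean ρ p t z) w + discreteLaplacian n (pairMean ρ p t w) z -
        if w = z + 1 then (n : ℝ) ^ 2 * (profile ρ p t z + profile ρ p t w -
          2 * pairMean ρ p t z w) else 0) t := by
  have h := hp.hasDerivAt (fun η => occ (η ⟨z, hz⟩) * occ (η ⟨w, hw⟩)) t
  simp only [generator_occ_mul_occ ρ (z := ⟨z, hz⟩) (w := ⟨w, hw⟩) hzw, generator_occ hn] at h
  simp only [← extOcc_site ρ, mul_sub, mul_add, Finset.sum_add_distrib, Finset.sum_sub_distrib,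
    sum_mul_extOcc_mul_discreteLaplacian] at h
  refine h.congr_deriv (congrArg _ ?_)
  split_ifs
  · rw [← sum_mul_sq_extOcc_sub hz hw, Finset.mul_sum]
    exact Finset.sum_congr rfl fun η _ => mul_left_comm _ _ _
  · simp only [mul_zero, Finset.sum_const_zero]

theorem hasDerivAt_corr (hp : IsForwardSolution n ρ p) (hn : 3 ≤ n) (t : ℝ) {z w : ℕ}
    (hz : 0 < z) (hzw : z < w) (hw : w < n) :
    HasDerivAt (fun s => corr ρ p s (z, w))
      (pairLaplacian n (corr ρ p t) (z, w) - if w = z + 1 then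
        (n : ℝ) ^ 2 * (profile ρ p t (z + 1) - profile ρ p t z) ^ 2 else 0) t := by
  have hz' : z ∈ Finset.Ioo 0 n := Finset.mem_Ioo.2 ⟨hz, hzw.trans hw⟩
  have hw' : w ∈ Finset.Ioo 0 n := Finset.mem_Ioo.2 ⟨hz.trans hzw, hw⟩
  refine ((hp.hasDerivAt_pairMean hn t hz' hw' hzw).sub
    ((hp.hasDerivAt_profile hn t hz').mul (hp.hasDerivAt_profile hn t hw'))).congr_deriv ?_
  simp only [pairLaplacian, discreteLaplacian, corr, pairMean_comm w]
  by_cases hadj : w = z + 1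
  · subst hadj
    simp only [if_true, Nat.add_sub_cancel, pairMean_self hz', pairMean_self hw']
    ring
  · simp only [hadj, if_false]
    ring

theorem neg_corr_le (hp : IsForwardSolution n ρ p) (hn : 3 ≤ n) {K : ℝ}
    (hgrad : ∀ t, 0 ≤ t → ∀ k < n, |profile ρ p t (k + 1) - profile ρ p t k| ≤ K / n)
    (h0 : ∀ z w, 0 < z → z < w → w < n → 0 ≤ corr ρ p 0 (z, w)) {t : ℝ} (ht : 0 ≤ t) {z w : ℕ}
    (hz : 0 < z) (hzw : z < w) (hw : w < n) :
    -corr ρ p t (z, w) ≤ 2 * K ^ 2 / n := by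
  have hn0 : (0 : ℝ) < n := by exact_mod_cast (by omega : 0 < n)
  have hbarrier := neg_le_of_hasDerivAt_pairLaplacian (by omega : 2 ≤ n) (sq_nonneg (K / n))
    (c := corr ρ p) (g := fun t k => (profile ρ p t (k + 1) - profile ρ p t k) ^ 2)
    (fun t _ z w => hp.hasDerivAt_corr hn t)
    (fun t w => hp.corr_of_notMem t (by simp) w)
    (fun t z => (corr_comm z n).trans (hp.corr_of_notMem t (by simp) z))
    (fun t ht k hk => sq_le_sq.2 ((hgrad t ht k hk).trans (le_abs_self _)))
    h0 ht hz hzw hw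
  have hzn : (z : ℝ) ≤ n := by exact_mod_cast (hzw.trans hw).le
  have hwn : (w : ℝ) ≤ n := by exact_mod_cast hw.le
  calc -corr ρ p t (z, w) ≤ 2 * (K / n) ^ 2 / n * (z * (n - w)) := hbarrier
    _ ≤ 2 * (K / n) ^ 2 / n * (n * n) := by
        gcongr
        exact sub_le_self _ w.cast_nonneg
    _ = 2 * K ^ 2 / n := by field_simp [hn0.ne']

end IsForwardSolution

/-! ### Positivity of the solutions of the forward equation -/

theorem le_mul_exp_of_hasDerivAt {H H' : ℝ → ℝ} {δ l M : ℝ} (hδ : δ < l) (hM : 0 ≤ M)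
    (hH : ∀ t, 0 ≤ t → HasDerivAt H (H' t) t)
    (hle : ∀ t, 0 ≤ t → H' t ≤ -δ * H t + M * Real.exp (-l * t)) {t : ℝ} (ht : 0 ≤ t) :
    H t ≤ (H 0 + M / (l - δ)) * Real.exp (-δ * t) := by
  have hexp : ∀ c s : ℝ, HasDerivAt (fun s => Real.exp (c * s)) (Real.exp (c * s) * c) s :=
    fun c s => by simpa using ((hasDerivAt_id s).const_mul c).exp
  set F : ℝ → ℝ := fun s => Real.exp (δ * s) * H s + M / (l - δ) * Real.exp ((δ - l) * s) with hF
  have hderiv : ∀ s, 0 ≤ s → HasDerivAt F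
      (Real.exp (δ * s) * (H' s + δ * H s - M * Real.exp (-l * s))) s := fun s hs => by
    refine (((hexp δ s).mul (hH s hs)).add
      ((hexp (δ - l) s).const_mul (M / (l - δ)))).congr_deriv ?_
    have hsplit : Real.exp ((δ - l) * s) = Real.exp (δ * s) * Real.exp (-l * s) := by
      rw [← Real.exp_add]
      ring_nf
    have hl : l - δ ≠ 0 := (sub_pos.2 hδ).ne'
    rw [hsplit]
    field_simp
    ring
  have hanti : AntitoneOn F (Ici 0) := by
    refine antitoneOn_of_deriv_nonpos (convex_Ici 0)
      (fun s hs => (hderiv s hs).continuousAt.continuousWithinAt) (fun s hs => ?_) fun s hs => ?_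
    all_goals have hs0 : 0 ≤ s := interior_subset hs
    · exact (hderiv s hs0).differentiableAt.differentiableWithinAt
    · rw [(hderiv s hs0).deriv]
      exact mul_nonpos_of_nonneg_of_nonpos (Real.exp_nonneg _) (by linarith [hle s hs0])
  have hM0 : 0 ≤ M / (l - δ) * Real.exp ((δ - l) * t) :=
    mul_nonneg (div_nonneg hM (sub_pos.2 hδ).le) (Real.exp_nonneg _)
  have hFt := hanti self_mem_Ici ht ht
  simp only [hF, mul_zero, Real.exp_zero, one_mul, mul_one] at hFt
  rw [neg_mul, Real.exp_neg, ← div_eq_mul_inv, le_div_iff₀ (Real.exp_pos _)]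
  linarith

theorem neg_mul_le_generator {n : ℕ} {ρ : ℝ} (hρ : ρ ∈ Icc (0 : ℝ) 1) {f : Config n → ℝ}
    (hf : ∀ η, 0 ≤ f η) (η : Config n) :
    -((n : ℝ) ^ 2 * ((bonds n).card + (boundary n).card)) * f η ≤ generator n ρ f η := by
  have hrate : ∀ b, rate ρ b ∈ Icc (0 : ℝ) 1 := fun b => by
    simpa using rate_mem_Icc (ε := 0) (by simpa using hρ) b
  have hbonds : (bonds n).card • (-f η) ≤ ∑ b ∈ bonds n, (f (exchange b.1 b.2 η) - f η) :=
    Finset.card_nsmul_le_sum _ _ _ fun b _ => by linarith [hf (exchange b.1 b.2 η)]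
  have hboundary : (boundary n).card • (-f η) ≤
      ∑ x ∈ boundary n, rate ρ (η x) * (f (flip x η) - f η) :=
    Finset.card_nsmul_le_sum _ _ _ fun x _ => by
      have hgain := mul_nonneg (hrate (η x)).1 (hf (flip x η))
      have hloss := mul_le_mul_of_nonneg_right (hrate (η x)).2 (hf η)
      rw [mul_sub]
      linarith
  rw [nsmul_eq_mul] at hbonds hboundary
  rw [generator_apply, ← mul_add]
  refine le_of_eq_of_le (by ring)
    (mul_le_mul_of_nonneg_left (add_le_add hbonds hboundary) (sq_nonneg (n : ℝ)))

namespace IsForwardSolution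

variable {n : ℕ} {ρ : ℝ} {p : ℝ → Config n → ℝ}

theorem exists_hasDerivAt (hp : IsForwardSolution n ρ p) (t : ℝ) :
    ∃ p' : Config n → ℝ, (∀ η, HasDerivAt (fun s => p s η) (p' η) t) ∧
      ∀ g : Config n → ℝ, ∑ η, p' η * g η = ∑ η, p t η * generator n ρ g η := by
  have hderiv : ∀ η, HasDerivAt (fun s => p s η)
      (∑ ξ, p t ξ * generator n ρ (Pi.single η 1) ξ) t := fun η => by
    simpa [Pi.single_apply] using hp.hasDerivAt (Pi.single η 1) t
  exact ⟨_, hderiv, fun g =>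
    (HasDerivAt.fun_sum fun η _ => (hderiv η).mul_const (g η)).unique (hp.hasDerivAt g t)⟩

theorem pos (hp : IsForwardSolution n ρ p) (hρ : ρ ∈ Icc (0 : ℝ) 1) (h0 : ∀ η, 0 < p 0 η) {t : ℝ}
    (ht : 0 ≤ t) (η : Config n) : 0 < p t η := by
  choose p' hp' hdual using hp.exists_hasDerivAt
  set c : ℝ := (n : ℝ) ^ 2 * ((bonds n).card + (boundary n).card)
  have hexit : ∀ s, 0 ≤ s → -c * p s η ≤ p' s η := fun s hs => by
    calc -c * p s η = ∑ ξ, p s ξ * (-c * (Pi.single η 1 : Config n → ℝ) ξ) := by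
          simp [Pi.single_apply, mul_comm]
      _ ≤ ∑ ξ, p s ξ * generator n ρ (Pi.single η 1) ξ := Finset.sum_le_sum fun ξ _ =>
          mul_le_mul_of_nonneg_left
            (neg_mul_le_generator hρ (Pi.single_nonneg.2 zero_le_one : (0 : Config n → ℝ) ≤ _) ξ)
            (hp.nonneg s hs ξ)
      _ = p' s η := by simp [← hdual, Pi.single_apply]
  have hle := le_mul_exp_of_hasDerivAt (H := fun s => -p s η) (δ := c) (lt_add_one c) le_rfl
    (fun s _ => (hp' s η).neg) (fun s hs => by linarith [hexit s hs]) ht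
  have hpos := mul_pos (h0 η) (Real.exp_pos (-c * t))
  rw [zero_div, add_zero] at hle
  linarith

end IsForwardSolution

/-! ### Entropy production -/

theorem mul_log_sub_log_le {a b : ℝ} (ha : 0 < a) (hb : 0 < b) :
    a * (Real.log b - Real.log a) ≤ (b - a) - (√b - √a) ^ 2 := by
  have hsqrt_a := Real.sqrt_pos.2 ha
  have hsqrt_b := Real.sqrt_pos.2 hb
  have hlog := Real.log_le_sub_one_of_pos (div_pos hsqrt_b hsqrt_a)
  rw [Real.log_div hsqrt_b.ne' hsqrt_a.ne', Real.log_sqrt ha.le, Real.log_sqrt hb.le] at hlog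
  calc a * (Real.log b - Real.log a) ≤ a * (2 * (√b / √a - 1)) :=
        mul_le_mul_of_nonneg_left (by linarith) ha.le
    _ = √a ^ 2 * (2 * (√b / √a - 1)) := by rw [Real.sq_sqrt ha.le]
    _ = (√b ^ 2 - √a ^ 2) - (√b - √a) ^ 2 := by field_simp; ring
    _ = _ := by rw [Real.sq_sqrt ha.le, Real.sq_sqrt hb.le]

section Generator

variable {n : ℕ} {ρ : ℝ}

theorem sum_mul_generator_log_le (hρ : ∀ b, 0 ≤ rate ρ b) {u : Site n → ℝ}
    (hw : ∀ η, 0 ≤ weight u η) {f : Config n → ℝ} (hf : ∀ η, 0 < f η) :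
    ∑ η, weight u η * f η * generator n ρ (fun ξ => Real.log (f ξ)) η ≤
      ∑ η, weight u η * generator n ρ f η - dirichlet n ρ u fun η => √(f η) := by
  have hbond : ∀ b ∈ bonds n,
      ∑ η, weight u η * f η * (Real.log (f (exchange b.1 b.2 η)) - Real.log (f η)) ≤
      ∑ η, weight u η * (f (exchange b.1 b.2 η) - f η) -
        ∑ η, weight u η * (√(f (exchange b.1 b.2 η)) - √(f η)) ^ 2 := fun b _ => by
    rw [← Finset.sum_sub_distrib]
    refine Finset.sum_le_sum fun η _ => ?_
    rw [mul_assoc, ← mul_sub]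
    exact mul_le_mul_of_nonneg_left (mul_log_sub_log_le (hf η) (hf _)) (hw η)
  have hboundary : ∀ x ∈ boundary n,
      ∑ η, weight u η * f η * (rate ρ (η x) * (Real.log (f (flip x η)) - Real.log (f η))) ≤
      ∑ η, weight u η * (rate ρ (η x) * (f (flip x η) - f η)) -
        ∑ η, weight u η * (rate ρ (η x) * (√(f (flip x η)) - √(f η)) ^ 2) := fun x _ => by
    rw [← Finset.sum_sub_distrib]
    refine Finset.sum_le_sum fun η _ => ?_
    rw [mul_assoc, mul_left_comm (f η), ← mul_sub, ← mul_sub (rate ρ (η x))]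
    exact mul_le_mul_of_nonneg_left
      (mul_le_mul_of_nonneg_left (mul_log_sub_log_le (hf η) (hf _)) (hρ _)) (hw η)
  have hsum := mul_le_mul_of_nonneg_left
    (add_le_add (Finset.sum_le_sum hbond) (Finset.sum_le_sum hboundary)) (sq_nonneg (n : ℝ))
  rw [Finset.sum_sub_distrib, Finset.sum_sub_distrib, mul_add] at hsum
  rw [sum_mul_generator ρ fun η => weight u η * f η, sum_mul_generator ρ (weight u), dirichlet]
  exact hsum.trans_eq (by ring)

theorem sum_mul_comp_exchange_sub (x y : Site n) (μ f : Config n → ℝ) :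
    ∑ η, μ η * (f (exchange x y η) - f η) = ∑ η, f η * (μ (exchange x y η) - μ η) := by
  have hswap : ∑ η, μ η * f (exchange x y η) = ∑ η, f η * μ (exchange x y η) := by
    rw [← sum_comp_exchange x y]
    exact Finset.sum_congr rfl fun η _ => by rw [exchange_involutive x y η, mul_comm]
  simp only [mul_sub, Finset.sum_sub_distrib, hswap, mul_comm (f _) (μ _)]

theorem sum_mul_rate_mul_comp_flip_sub (ρ : ℝ) (x : Site n) (μ f : Config n → ℝ) :
    ∑ η, μ η * (rate ρ (η x) * (f (flip x η) - f η)) =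
      ∑ η, f η * (μ (flip x η) * rate ρ (!η x) - μ η * rate ρ (η x)) := by
  have hswap : ∑ η, μ η * (rate ρ (η x) * f (flip x η)) =
      ∑ η, f η * (μ (flip x η) * rate ρ (!η x)) := by
    rw [← sum_comp_flip x]
    exact Finset.sum_congr rfl fun η _ => by rw [flip_involutive x η, flip_self]; ring
  have hdiag : ∑ η, μ η * (rate ρ (η x) * f η) = ∑ η, f η * (μ η * rate ρ (η x)) :=
    Finset.sum_congr rfl fun η _ => by ring
  simp only [mul_sub, Finset.sum_sub_distrib, hswap, hdiag]

-- The adjoint of the generator in `L²` of a product measure, applied to the constant `1`.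
theorem sum_weight_mul_generator (hn : 3 ≤ n) {U : ℕ → ℝ} (h0 : U 0 = ρ) (h1 : U n = ρ)
    (hw : ∀ (x : Site n) b, siteWeight (U x.1) b ≠ 0) (f : Config n → ℝ) :
    ∑ η, weight (fun x : Site n => U x.1) η * generator n ρ f η =
      ∑ η, weight (fun x : Site n => U x.1) η * f η *
        (∑ x : Site n, discreteLaplacian n U x.1 * score (U x.1) (η x) -
          (n : ℝ) ^ 2 * ∑ b ∈ bonds n, (U b.2.1 - U b.1.1) ^ 2 *
            (score (U b.1.1) (η b.1) * score (U b.2.1) (η b.2))) := by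
  set u : Site n → ℝ := fun x => U x.1
  have hbond : ∀ b ∈ bonds n, ∑ η, weight u η * (f (exchange b.1 b.2 η) - f η) =
      ∑ η, weight u η * f η * ((u b.2 - u b.1) * (score (u b.1) (η b.1) - score (u b.2) (η b.2)) -
        (u b.2 - u b.1) ^ 2 * (score (u b.1) (η b.1) * score (u b.2) (η b.2))) := fun b hb => by
    rw [sum_mul_comp_exchange_sub]
    exact Finset.sum_congr rfl fun η _ => by
      rw [weight_exchange_sub (ne_of_mem_bonds hb) (hw _ _) (hw _ _)]; ring
  have hboundary : ∀ x ∈ boundary n, ∑ η, weight u η * (rate ρ (η x) * (f (flip x η) - f η)) =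
      ∑ η, weight u η * f η * ((ρ - u x) * score (u x) (η x)) := fun x _ => by
    rw [sum_mul_rate_mul_comp_flip_sub]
    exact Finset.sum_congr rfl fun η _ => by rw [weight_flip_mul_rate_sub ρ (hw _ _)]; ring
  rw [sum_mul_generator, Finset.sum_congr rfl hbond, Finset.sum_congr rfl hboundary,
    Finset.sum_comm, Finset.sum_comm (s := boundary n), Finset.mul_sum, Finset.mul_sum,
    ← Finset.sum_add_distrib]
  refine Finset.sum_congr rfl fun η _ => ?_
  rw [sum_discreteLaplacian_mul hn h0 h1 fun x => score (u x) (η x), ← Finset.mul_sum,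
    ← Finset.mul_sum, Finset.sum_sub_distrib]
  ring

end Generator

theorem hasDerivAt_weight {n : ℕ} {u : ℝ → Site n → ℝ} {u' : Site n → ℝ} {t : ℝ} {η : Config n}
    (hu : ∀ x, HasDerivAt (fun s => u s x) (u' x) t)
    (hw : ∀ x, siteWeight (u t x) (η x) ≠ 0) :
    HasDerivAt (fun s => weight (u s) η)
      (weight (u t) η * ∑ x, u' x * score (u t x) (η x)) t := by
  have hsite : ∀ x, HasDerivAt (fun s => siteWeight (u s x) (η x)) (u' x * (2 * occ (η x) - 1)) t :=
    fun x => (((hu x).const_mul _).add (((hu x).const_sub 1).const_mul _)).congr_deriv (by ring)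
  refine (HasDerivAt.fun_finsetProd fun x _ => hsite x).congr_deriv ?_
  rw [Finset.mul_sum]
  refine Finset.sum_congr rfl fun x _ => ?_
  rw [weight, ← Finset.prod_erase_mul _ _ (Finset.mem_univ x), score, smul_eq_mul]
  field_simp [hw x]

theorem hasDerivAt_sum_mul_log_div {ι : Type*} [Fintype ι] {p ν : ℝ → ι → ℝ} {p' ν' : ι → ℝ}
    {t : ℝ} (hp : ∀ i, HasDerivAt (fun s => p s i) (p' i) t) (hp0 : ∀ i, p t i ≠ 0)
    (hν : ∀ i, HasDerivAt (fun s => ν s i) (ν t i * ν' i) t) (hν0 : ∀ i, ν t i ≠ 0) :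
    HasDerivAt (fun s => ∑ i, p s i * Real.log (p s i / ν s i))
      (∑ i, p' i * Real.log (p t i / ν t i) + ∑ i, p' i - ∑ i, p t i * ν' i) t := by
  have hterm : ∀ i, HasDerivAt (fun s => p s i * Real.log (p s i / ν s i))
      (p' i * Real.log (p t i / ν t i) + p' i - p t i * ν' i) t := fun i => by
    have hlog := ((hp i).div (hν i) (hν0 i)).log (div_ne_zero (hp0 i) (hν0 i))
    refine ((hp i).mul hlog).congr_deriv ?_
    have hpi := hp0 i
    have hνi := hν0 i
    simp only [Pi.div_apply]
    field_simp
    ring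
  refine (HasDerivAt.fun_sum fun i _ => hterm i).congr_deriv ?_
  rw [Finset.sum_sub_distrib, Finset.sum_add_distrib]

/-- The density of `p` with respect to the Bernoulli product measure with the same occupation
densities. -/
def relDensity {n : ℕ} (ρ : ℝ) (p : ℝ → Config n → ℝ) (t : ℝ) (η : Config n) : ℝ :=
  p t η / weight (fun x : Site n => profile ρ p t x.1) η

/-- The relative entropy of `p` with respect to the Bernoulli product measure with the same
occupation densities. -/
def entropy {n : ℕ} (ρ : ℝ) (p : ℝ → Config n → ℝ) (t : ℝ) : ℝ :=
  ∑ η, p t η * Real.log (relDensity ρ p t η)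

/-- The time derivative of the relative entropy along the forward equation. -/
def entropyDeriv {n : ℕ} (ρ : ℝ) (p : ℝ → Config n → ℝ) (t : ℝ) : ℝ :=
  ∑ η, p t η * generator n ρ (fun ξ => Real.log (relDensity ρ p t ξ)) η -
    ∑ η, p t η * ∑ x : Site n, discreteLaplacian n (profile ρ p t) x.1 *
      score (profile ρ p t x.1) (η x)

namespace IsForwardSolution

variable {n : ℕ} {ρ t : ℝ} {p : ℝ → Config n → ℝ}

theorem hasDerivAt_entropy (hp : IsForwardSolution n ρ p) (hn : 3 ≤ n) (hpos : ∀ η, 0 < p t η)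
    (hw : ∀ (x : Site n) b, 0 < siteWeight (profile ρ p t x.1) b) :
    HasDerivAt (entropy ρ p) (entropyDeriv ρ p t) t := by
  obtain ⟨p', hp', hdual⟩ := hp.exists_hasDerivAt t
  have hmass : ∑ η, p' η = 0 := by
    simpa [generator_const] using hdual fun _ => 1
  have hweight : ∀ η, HasDerivAt (fun s => weight (fun x : Site n => profile ρ p s x.1) η) _ t :=
    fun η => hasDerivAt_weight (fun x => hp.hasDerivAt_profile hn t x.2) fun x => (hw x _).ne'
  refine (hasDerivAt_sum_mul_log_div hp' (fun η => (hpos η).ne') hweight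
    fun η => (weight_pos hw η).ne').congr_deriv ?_
  rw [hmass, add_zero, entropyDeriv, ← hdual]
  rfl

theorem entropyDeriv_le (hp : IsForwardSolution n ρ p) (hn : 3 ≤ n)
    (hρ : ∀ b, 0 ≤ rate ρ b) (hpos : ∀ η, 0 < p t η)
    (hw : ∀ (x : Site n) b, 0 < siteWeight (profile ρ p t x.1) b) :
    entropyDeriv ρ p t ≤
      -dirichlet n ρ (fun x : Site n => profile ρ p t x.1) (fun η => √(relDensity ρ p t η)) -
        (n : ℝ) ^ 2 * ∑ b ∈ bonds n, (profile ρ p t b.2.1 - profile ρ p t b.1.1) ^ 2 *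
          ∑ η, p t η * (score (profile ρ p t b.1.1) (η b.1) *
            score (profile ρ p t b.2.1) (η b.2)) := by
  have hν : ∀ η, 0 < weight (fun x : Site n => profile ρ p t x.1) η := weight_pos hw
  have hνf : ∀ η, weight (fun x : Site n => profile ρ p t x.1) η * relDensity ρ p t η = p t η :=
    fun η => mul_div_cancel₀ _ (hν η).ne'
  have hlog := sum_mul_generator_log_le hρ (fun η => (hν η).le)
    (f := relDensity ρ p t) fun η => div_pos (hpos η) (hν η)
  have hadjoint := sum_weight_mul_generator hn (hp.profile_of_notMem t (k := 0) (by simp))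
    (hp.profile_of_notMem t (k := n) (by simp)) (fun x b => (hw x b).ne') (relDensity ρ p t)
  have hcorr : ∑ η, p t η * ((n : ℝ) ^ 2 * ∑ b ∈ bonds n,
      (profile ρ p t b.2.1 - profile ρ p t b.1.1) ^ 2 *
        (score (profile ρ p t b.1.1) (η b.1) * score (profile ρ p t b.2.1) (η b.2))) =
      (n : ℝ) ^ 2 * ∑ b ∈ bonds n, (profile ρ p t b.2.1 - profile ρ p t b.1.1) ^ 2 *
        ∑ η, p t η * (score (profile ρ p t b.1.1) (η b.1) *
          score (profile ρ p t b.2.1) (η b.2)) := by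
    simp only [Finset.mul_sum]
    rw [Finset.sum_comm]
    exact Finset.sum_congr rfl fun b _ => Finset.sum_congr rfl fun η _ => by ring
  simp only [hνf, mul_sub (p t _), Finset.sum_sub_distrib, hcorr] at hlog hadjoint
  rw [entropyDeriv]
  linarith

theorem sum_mul_score_mul_score (hp : IsForwardSolution n ρ p) {x y : Site n}
    (hx : profile ρ p t x.1 ∈ Ioo (0 : ℝ) 1) (hy : profile ρ p t y.1 ∈ Ioo (0 : ℝ) 1) :
    ∑ η, p t η * (score (profile ρ p t x.1) (η x) * score (profile ρ p t y.1) (η y)) =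
      corr ρ p t (x.1, y.1) / (profile ρ p t x.1 * (1 - profile ρ p t x.1) *
        (profile ρ p t y.1 * (1 - profile ρ p t y.1))) := by
  have hcov : corr ρ p t (x.1, y.1) = ∑ η, p t η *
      ((occ (η x) - profile ρ p t x.1) * (occ (η y) - profile ρ p t y.1)) := by
    have hexpand : ∀ a b η, p t η * ((occ (η x) - a) * (occ (η y) - b)) =
        p t η * (occ (η x) * occ (η y)) - p t η * occ (η x) * b - p t η * occ (η y) * a +
          p t η * (a * b) := fun a b η => by ring
    have hmean : ∀ z : Site n, ∑ η, p t η * occ (η z) = profile ρ p t z.1 := fun z => by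
      simp only [profile, extOcc_site]
    simp only [hexpand, Finset.sum_add_distrib, Finset.sum_sub_distrib, ← Finset.sum_mul, hmean,
      hp.sum_eq_one, corr, pairMean, extOcc_site]
    ring
  rw [hcov, Finset.sum_div]
  refine Finset.sum_congr rfl fun η _ => ?_
  rw [score_eq_div hx.1 hx.2, score_eq_div hy.1 hy.2, div_mul_div_comm, mul_div_assoc']

theorem neg_sum_score_le (hp : IsForwardSolution n ρ p) {ε A C : ℝ} (hε : 0 < ε) (hC : 0 ≤ C)
    (hu : ∀ k, profile ρ p t k ∈ Icc ε (1 - ε))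
    (hgrad : ∀ b ∈ bonds n, |profile ρ p t b.2.1 - profile ρ p t b.1.1| ≤ A)
    (hcorr : ∀ b ∈ bonds n, -corr ρ p t (b.1.1, b.2.1) ≤ C) :
    -∑ b ∈ bonds n, (profile ρ p t b.2.1 - profile ρ p t b.1.1) ^ 2 *
        ∑ η, p t η * (score (profile ρ p t b.1.1) (η b.1) *
          score (profile ρ p t b.2.1) (η b.2)) ≤ n * (A ^ 2 * (C / ε ^ 4)) := by
  have hmem : ∀ k, profile ρ p t k ∈ Ioo (0 : ℝ) 1 := fun k =>
    ⟨hε.trans_le (hu k).1, by linarith [(hu k).2]⟩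
  have hχ : ∀ k, ε ^ 2 ≤ profile ρ p t k * (1 - profile ρ p t k) := fun k => by
    rw [sq]
    exact mul_le_mul (hu k).1 (by linarith [(hu k).2]) hε.le (hmem k).1.le
  have hC4 : 0 ≤ A ^ 2 * (C / ε ^ 4) := by positivity
  rw [← Finset.sum_neg_distrib]
  refine (Finset.sum_le_card_nsmul _ _ (A ^ 2 * (C / ε ^ 4)) fun b hb => ?_).trans ?_
  · have hχχ : ε ^ 4 ≤ profile ρ p t b.1.1 * (1 - profile ρ p t b.1.1) *
        (profile ρ p t b.2.1 * (1 - profile ρ p t b.2.1)) := by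
      rw [show ε ^ 4 = ε ^ 2 * ε ^ 2 by ring]
      exact mul_le_mul (hχ _) (hχ _) (sq_nonneg ε) ((sq_nonneg ε).trans (hχ _))
    rw [hp.sum_mul_score_mul_score (hmem _) (hmem _), ← mul_neg, ← neg_div]
    exact (mul_le_mul_of_nonneg_left
      (div_le_div₀ hC (hcorr b hb) (pow_pos hε 4) hχχ) (sq_nonneg _)).trans
      (mul_le_mul_of_nonneg_right (sq_le_sq.2 ((hgrad b hb).trans (le_abs_self A)))
        (div_nonneg hC (pow_pos hε 4).le))
  · rw [nsmul_eq_mul]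
    exact mul_le_mul_of_nonneg_right (by exact_mod_cast card_bonds_le n) hC4

theorem entropy_le_dirichlet (hp : IsForwardSolution n ρ p) {ε K : ℝ} (hε : 0 < ε) (hK : 0 ≤ K)
    (hρ : ρ ∈ Icc ε (1 - ε)) (hpos : ∀ η, 0 < p t η)
    (hu : ∀ k, profile ρ p t k ∈ Icc ε (1 - ε))
    (hgrad : ∀ b ∈ bonds n, |profile ρ p t b.2.1 - profile ρ p t b.1.1| ≤ K / n) :
    entropy ρ p t ≤ sobolevConst ε K * dirichlet n ρ (fun x : Site n => profile ρ p t x.1)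
      fun η => √(relDensity ρ p t η) := by
  have hν : ∀ η, 0 < weight (fun x : Site n => profile ρ p t x.1) η :=
    weight_pos fun x => siteWeight_pos hε (hu x.1)
  have hνf : ∀ η, weight (fun x : Site n => profile ρ p t x.1) η * relDensity ρ p t η = p t η :=
    fun η => mul_div_cancel₀ _ (hν η).ne'
  have hsobolev := sum_weight_mul_log_le_dirichlet (f := relDensity ρ p t) hε hK hρ
    (fun x : Site n => hu x.1) hgrad (fun η => div_pos (hpos η) (hν η))
    (by simp only [hνf, hp.sum_eq_one])
  simpa only [entropy, ← mul_assoc, hνf] using hsobolev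

theorem entropyDeriv_le_neg_mul_entropy_add (hp : IsForwardSolution n ρ p) (hn : 3 ≤ n) {ε K : ℝ}
    (hε : 0 < ε) (hK : 0 ≤ K) (ht : 0 ≤ t) (hρ : ρ ∈ Icc ε (1 - ε)) (hpos : ∀ η, 0 < p t η)
    (hu : ∀ k, profile ρ p t k ∈ Icc ε (1 - ε))
    (hgrad : ∀ b ∈ bonds n,
      |profile ρ p t b.2.1 - profile ρ p t b.1.1| ≤ K / n * Real.exp (-2 * t))
    (hcorr : ∀ b ∈ bonds n, -corr ρ p t (b.1.1, b.2.1) ≤ 2 * K ^ 2 / n) :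
    entropyDeriv ρ p t ≤ -(1 / sobolevConst ε K) * entropy ρ p t +
      2 * K ^ 4 / ε ^ 4 * Real.exp (-4 * t) := by
  have hn0 : (0 : ℝ) < n := by exact_mod_cast (by omega : 0 < n)
  have hsobolev := hp.entropy_le_dirichlet hε hK hρ hpos hu fun b hb => (hgrad b hb).trans
    (mul_le_of_le_one_right (div_nonneg hK hn0.le) (Real.exp_le_one_iff.2 (by linarith)))
  rw [mul_comm, ← div_le_iff₀ (one_pos.trans_le (one_le_sobolevConst hε))] at hsobolev
  have hscore := mul_le_mul_of_nonneg_left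
    (hp.neg_sum_score_le hε (div_nonneg (by positivity) hn0.le) hu hgrad hcorr) (sq_nonneg (n : ℝ))
  have herror : (n : ℝ) ^ 2 * (n * ((K / n * Real.exp (-2 * t)) ^ 2 * (2 * K ^ 2 / n / ε ^ 4))) =
      2 * K ^ 4 / ε ^ 4 * Real.exp (-4 * t) := by
    rw [show Real.exp (-4 * t) = Real.exp (-2 * t) ^ 2 by rw [← Real.exp_nat_mul]; ring_nf]
    field_simp
  have hrate : ∀ b, 0 ≤ rate ρ b := fun b => hε.le.trans (rate_mem_Icc hρ b).1
  have hproduction := hp.entropyDeriv_le hn hrate hpos fun x => siteWeight_pos hε (hu x.1)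
  rw [herror] at hscore
  rw [neg_mul, one_div_mul_eq_div]
  linarith

end IsForwardSolution

/-! ### Exponential decay of the entropy -/

theorem sum_weight_mul_occ {n : ℕ} (u : Site n → ℝ) (x : Site n) :
    ∑ η, weight u η * occ (η x) = u x := by
  have hmean : ∀ η, condAvg u x (fun η => occ (η x)) η = u x := fun η => by
    simp [condAvg, occ, siteWeight]
  rw [← sum_weight_mul_condAvg u x]
  simp only [hmean, ← Finset.sum_mul, sum_weight_eq_one, one_mul]

theorem sum_weight_mul_occ_mul_occ {n : ℕ} (u : Site n → ℝ) {x y : Site n} (hxy : x ≠ y) :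
    ∑ η, weight u η * (occ (η x) * occ (η y)) = u x * u y := by
  have hmean : ∀ η, condAvg u x (fun η => occ (η x) * occ (η y)) η = u x * occ (η y) :=
    fun η => by simp [condAvg, occ, siteWeight, Function.update_of_ne hxy.symm]
  rw [← sum_weight_mul_condAvg u x]
  simp only [hmean, mul_left_comm, ← Finset.mul_sum, sum_weight_mul_occ]

section InitialLaw

variable {n : ℕ} {ρ : ℝ} {p : ℝ → Config n → ℝ} {u : Site n → ℝ}

theorem profile_of_eq_weight {t : ℝ} (h : p t = weight u) (x : Site n) :
    profile ρ p t x.1 = u x := by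
  simp only [profile, extOcc_site, h, sum_weight_mul_occ]

theorem corr_of_eq_weight {t : ℝ} (h : p t = weight u) {x y : Site n} (hxy : x ≠ y) :
    corr ρ p t (x.1, y.1) = 0 := by
  simp only [corr, pairMean, profile_of_eq_weight h, extOcc_site, h,
    sum_weight_mul_occ_mul_occ u hxy, sub_self]

theorem entropy_of_eq_weight {t : ℝ} (h : p t = weight u) : entropy ρ p t = 0 := by
  refine Finset.sum_eq_zero fun η _ => ?_
  simp only [relDensity, profile_of_eq_weight h, h]
  by_cases hη : weight u η = 0
  · rw [hη, zero_mul]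
  · rw [div_self hη, Real.log_one, mul_zero]

end InitialLaw

/-- The Lipschitz analogue of the class `IsProfile` of initial profiles. -/
structure IsLipschitzProfile (ρ ε : ℝ) (κ : ℝ≥0) (u : ℝ → ℝ) : Prop where
  lipschitzOnWith : LipschitzOnWith κ u (Icc 0 1)
  mem_Icc : ∀ x ∈ Icc (0 : ℝ) 1, u x ∈ Icc ε (1 - ε)
  left : u 0 = ρ
  right : u 1 = ρ

theorem IsProfile.isLipschitzProfile {ρ ε : ℝ} {κ : ℝ≥0} {u : ℝ → ℝ} (h : IsProfile ρ ε κ u) :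
    IsLipschitzProfile ρ ε κ u :=
  ⟨(convex_Icc 0 1).lipschitzOnWith_of_nnnorm_derivWithin_le h.differentiableOn h.abs_deriv_le,
    h.mem_Icc, h.left, h.right⟩

namespace IsLipschitzProfile

variable {ρ ε : ℝ} {κ : ℝ≥0} {u₀ : ℝ → ℝ} {n k : ℕ}

theorem natCast_div_mem_Icc (h : IsLipschitzProfile ρ ε κ u₀) (hk : k ≤ n) :
    u₀ ((k : ℝ) / n) ∈ Icc ε (1 - ε) :=
  h.mem_Icc _ (unitInterval.div_mem k.cast_nonneg n.cast_nonneg (Nat.cast_le.2 hk))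

theorem weight_pos (h : IsLipschitzProfile ρ ε κ u₀) (hε : 0 < ε) (n : ℕ) (η : Config n) :
    0 < weight (fun x : Site n => u₀ ((x.1 : ℝ) / n)) η :=
  SSEP.weight_pos (fun x => siteWeight_pos hε
    (h.natCast_div_mem_Icc (Finset.mem_Ioo.1 x.2).2.le)) η

theorem abs_sub_le (h : IsLipschitzProfile ρ ε κ u₀) (hk : k < n) :
    |u₀ (((k + 1 : ℕ) : ℝ) / n) - u₀ ((k : ℝ) / n)| ≤ κ / n := by
  have hmem : ∀ j ≤ n, (j : ℝ) / n ∈ Icc (0 : ℝ) 1 := fun j hj =>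
    unitInterval.div_mem j.cast_nonneg n.cast_nonneg (Nat.cast_le.2 hj)
  have hlip := h.lipschitzOnWith.dist_le_mul _ (hmem (k + 1) hk) _ (hmem k hk.le)
  rw [Real.dist_eq, Real.dist_eq, ← sub_div, Nat.cast_add_one, add_sub_cancel_left,
    abs_of_nonneg (a := 1 / (n : ℝ)) (by positivity), mul_one_div] at hlip
  rwa [Nat.cast_add_one]

end IsLipschitzProfile

namespace IsForwardSolution

variable {n : ℕ} {ρ ε t : ℝ} {κ : ℝ≥0} {p : ℝ → Config n → ℝ} {u₀ : ℝ → ℝ}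

theorem profile_zero (hp : IsForwardSolution n ρ p) (hn : 0 < n)
    (hu₀ : IsLipschitzProfile ρ ε κ u₀) (h0 : p 0 = weight fun x : Site n => u₀ ((x.1 : ℝ) / n))
    {k : ℕ} (hk : k ≤ n) : profile ρ p 0 k = u₀ ((k : ℝ) / n) := by
  by_cases hmem : k ∈ Finset.Ioo 0 n
  · exact profile_of_eq_weight h0 ⟨k, hmem⟩
  · rw [hp.profile_of_notMem 0 hmem]
    obtain rfl | rfl : k = 0 ∨ k = n := by
      rw [Finset.mem_Ioo] at hmem
      omega
    · rw [Nat.cast_zero, zero_div, hu₀.left]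
    · rw [div_self (Nat.cast_ne_zero.2 hn.ne'), hu₀.right]

theorem profile_mem_Icc_of_isLipschitzProfile (hp : IsForwardSolution n ρ p) (hn : 3 ≤ n)
    (hu₀ : IsLipschitzProfile ρ ε κ u₀) (h0 : p 0 = weight fun x : Site n => u₀ ((x.1 : ℝ) / n))
    (ht : 0 ≤ t) (k : ℕ) : profile ρ p t k ∈ Icc ε (1 - ε) := by
  refine hp.profile_mem_Icc hn (fun k => ?_) ht k
  by_cases hmem : k ∈ Finset.Ioo 0 n
  · have hk := (Finset.mem_Ioo.1 hmem).2.le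
    rw [hp.profile_zero (by omega) hu₀ h0 hk]
    exact hu₀.natCast_div_mem_Icc hk
  · rw [hp.profile_of_notMem 0 hmem, ← hu₀.left]
    exact hu₀.mem_Icc 0 (by simp)

theorem pos_of_isLipschitzProfile (hp : IsForwardSolution n ρ p) (hε : 0 < ε)
    (hu₀ : IsLipschitzProfile ρ ε κ u₀) (h0 : p 0 = weight fun x : Site n => u₀ ((x.1 : ℝ) / n))
    (ht : 0 ≤ t) (η : Config n) : 0 < p t η := by
  have hρ : ρ ∈ Icc ε (1 - ε) := hu₀.left ▸ hu₀.mem_Icc 0 (by simp)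
  refine hp.pos ⟨hε.le.trans hρ.1, by linarith [hρ.2]⟩ (fun ξ => ?_) ht η
  rw [h0]
  exact hu₀.weight_pos hε n ξ

theorem abs_profile_sub_le_of_isLipschitzProfile (hp : IsForwardSolution n ρ p) (hn : 3 ≤ n)
    (hu₀ : IsLipschitzProfile ρ ε κ u₀) (h0 : p 0 = weight fun x : Site n => u₀ ((x.1 : ℝ) / n))
    (ht : 0 ≤ t) {k : ℕ} (hk : k < n) :
    |profile ρ p t (k + 1) - profile ρ p t k| ≤ 4 * κ / n * Real.exp (-2 * t) := by
  have hinit : ∀ k < n, |profile ρ p 0 (k + 1) - profile ρ p 0 k| ≤ κ / n := fun k hk => by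
    rw [hp.profile_zero (by omega) hu₀ h0 hk, hp.profile_zero (by omega) hu₀ h0 hk.le]
    exact hu₀.abs_sub_le hk
  exact (hp.abs_profile_sub_le hn (by positivity) hinit ht hk).trans_eq (by ring)

theorem neg_corr_le_of_isLipschitzProfile (hp : IsForwardSolution n ρ p) (hn : 3 ≤ n)
    (hu₀ : IsLipschitzProfile ρ ε κ u₀) (h0 : p 0 = weight fun x : Site n => u₀ ((x.1 : ℝ) / n))
    (ht : 0 ≤ t) {z w : ℕ} (hz : 0 < z) (hzw : z < w) (hw : w < n) :
    -corr ρ p t (z, w) ≤ 2 * (4 * κ) ^ 2 / n := by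
  refine hp.neg_corr_le hn (fun s hs k hk => ?_) (fun z w hz hzw hw => ?_) ht hz hzw hw
  · exact (hp.abs_profile_sub_le_of_isLipschitzProfile hn hu₀ h0 hs hk).trans
      (mul_le_of_le_one_right (by positivity) (Real.exp_le_one_iff.2 (by linarith)))
  · have hz' : z ∈ Finset.Ioo 0 n := Finset.mem_Ioo.2 ⟨hz, hzw.trans hw⟩
    have hw' : w ∈ Finset.Ioo 0 n := Finset.mem_Ioo.2 ⟨hz.trans hzw, hw⟩
    exact (corr_of_eq_weight h0 (x := ⟨z, hz'⟩) (y := ⟨w, hw'⟩)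
      fun h => hzw.ne (congrArg Subtype.val h)).ge

theorem entropy_le (hp : IsForwardSolution n ρ p) (hn : 3 ≤ n) (hε : 0 < ε)
    (hu₀ : IsLipschitzProfile ρ ε κ u₀) (h0 : p 0 = weight fun x : Site n => u₀ ((x.1 : ℝ) / n))
    (ht : 0 ≤ t) :
    entropy ρ p t ≤ 2 * (4 * κ) ^ 4 / ε ^ 4 *
      Real.exp (-(1 / sobolevConst ε (4 * κ)) * t) := by
  have hρ : ρ ∈ Icc ε (1 - ε) := hu₀.left ▸ hu₀.mem_Icc 0 (by simp)
  have hδ : 1 / sobolevConst ε (4 * κ) ≤ 1 :=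
    (div_le_one (one_pos.trans_le (one_le_sobolevConst hε))).2 (one_le_sobolevConst hε)
  have hpos := fun s (hs : 0 ≤ s) => hp.pos_of_isLipschitzProfile hε hu₀ h0 hs
  have hu := fun s (hs : 0 ≤ s) => hp.profile_mem_Icc_of_isLipschitzProfile hn hu₀ h0 hs
  have hM : 0 ≤ 2 * (4 * (κ : ℝ)) ^ 4 / ε ^ 4 := by positivity
  refine (le_mul_exp_of_hasDerivAt (l := 4) (hδ.trans_lt (by norm_num)) hM
    (fun s hs => hp.hasDerivAt_entropy hn (hpos s hs) fun x => siteWeight_pos hε (hu s hs x.1))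
    (fun s hs => hp.entropyDeriv_le_neg_mul_entropy_add hn hε (by positivity) hs hρ (hpos s hs)
      (hu s hs) (fun b hb => ?_) fun b hb => ?_) ht).trans ?_
  · rw [mem_bonds.1 hb]
    exact hp.abs_profile_sub_le_of_isLipschitzProfile hn hu₀ h0 hs
      (Finset.mem_Ioo.1 b.1.2).2
  · have hb' := mem_bonds.1 hb
    exact hp.neg_corr_le_of_isLipschitzProfile hn hu₀ h0 hs (Finset.mem_Ioo.1 b.1.2).1
      (by omega) (Finset.mem_Ioo.1 b.2.2).2
  · rw [entropy_of_eq_weight h0, zero_add]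
    exact mul_le_mul_of_nonneg_right (div_le_self hM (by linarith)) (Real.exp_pos _).le

end IsForwardSolution

/-! ### The law of the process -/

theorem bernoulliProduct_singleton {n : ℕ} (u : Site n → ℝ) (η : Config n) :
    bernoulliProduct u {η} = ENNReal.ofReal (weight u η) := by
  simp only [bernoulliProduct, Measure.finsetSum_apply, Measure.smul_apply, smul_eq_mul]
  rw [Finset.sum_eq_single η]
  · simp [weight, siteWeight]
  · intro ξ _ hξ
    simp [hξ]
  · simp

theorem isProbabilityMeasure_bernoulliProduct {n : ℕ} {u : Site n → ℝ} (hu : ∀ η, 0 ≤ weight u η) :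
    IsProbabilityMeasure (bernoulliProduct u) := by
  have hsum := sum_measure_singleton (μ := bernoulliProduct u) (s := Finset.univ)
  simp only [bernoulliProduct_singleton, Finset.coe_univ] at hsum
  exact ⟨by rw [← hsum, ← ENNReal.ofReal_sum_of_nonneg fun η _ => hu η, sum_weight_eq_one,
    ENNReal.ofReal_one]⟩

theorem integral_bernoulliProduct {n : ℕ} {u : Site n → ℝ} (hu : ∀ η, 0 ≤ weight u η)
    (f : Config n → ℝ) : ∫ ξ, f ξ ∂bernoulliProduct u = ∑ ξ, weight u ξ * f ξ := by
  have := isProbabilityMeasure_bernoulliProduct hu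
  rw [integral_fintype .of_finite]
  refine Finset.sum_congr rfl fun ξ _ => ?_
  rw [measureReal_def, bernoulliProduct_singleton, ENNReal.toReal_ofReal (hu ξ), smul_eq_mul]

section RelativeEntropy

variable {n : ℕ} {μ : Measure (Config n)} {q : Config n → ℝ} {u : Site n → ℝ}

theorem withDensity_bernoulliProduct (hμ : ∀ η, μ {η} = ENNReal.ofReal (q η)) (hq : ∀ η, 0 ≤ q η)
    (hu : ∀ η, 0 < weight u η) :
    (bernoulliProduct u).withDensity (fun η => ENNReal.ofReal (q η / weight u η)) = μ := by
  refine Measure.ext_of_singleton fun η => ?_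
  rw [withDensity_apply _ (measurableSet_singleton η), lintegral_singleton,
    bernoulliProduct_singleton, hμ, ← ENNReal.ofReal_mul (div_nonneg (hq η) (hu η).le),
    div_mul_cancel₀ _ (hu η).ne']

theorem rnDeriv_bernoulliProduct (hμ : ∀ η, μ {η} = ENNReal.ofReal (q η)) (hq : ∀ η, 0 ≤ q η)
    (hu : ∀ η, 0 < weight u η) (η : Config n) :
    μ.rnDeriv (bernoulliProduct u) η = ENNReal.ofReal (q η / weight u η) := by
  have := isProbabilityMeasure_bernoulliProduct fun η => (hu η).le
  have hae := Measure.rnDeriv_withDensity (bernoulliProduct u)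
    (f := fun η => ENNReal.ofReal (q η / weight u η)) (measurable_of_finite _)
  rw [withDensity_bernoulliProduct hμ hq hu] at hae
  refine ae_iff_of_countable.1 hae η ?_
  rw [bernoulliProduct_singleton]
  exact (ENNReal.ofReal_pos.2 (hu η)).ne'

theorem klDiv_bernoulliProduct [IsProbabilityMeasure μ] (hμ : ∀ η, μ {η} = ENNReal.ofReal (q η))
    (hq : ∀ η, 0 ≤ q η) (hu : ∀ η, 0 < weight u η) :
    InformationTheory.klDiv μ (bernoulliProduct u) =
      ENNReal.ofReal (∑ η, q η * Real.log (q η / weight u η)) := by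
  have := isProbabilityMeasure_bernoulliProduct fun η => (hu η).le
  have hac : μ ≪ bernoulliProduct u := by
    rw [← withDensity_bernoulliProduct hμ hq hu]
    exact withDensity_absolutelyContinuous _ _
  rw [InformationTheory.klDiv_of_ac_of_integrable hac .of_finite, integral_fintype .of_finite]
  simp only [probReal_univ, add_sub_cancel_right, smul_eq_mul]
  congr 1
  refine Finset.sum_congr rfl fun η _ => ?_
  rw [llr, rnDeriv_bernoulliProduct hμ hq hu, ENNReal.toReal_ofReal (div_nonneg (hq η) (hu η).le),
    measureReal_def, hμ, ENNReal.toReal_ofReal (hq η)]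

end RelativeEntropy

/-- The weights at time `t` of the chain started from the weights `w`. The semigroup acts on
functions, so this is its dual, tested on indicators. -/
def evolvedWeight (n : ℕ) (ρ : ℝ) (w : Config n → ℝ) (t : ℝ) (η : Config n) : ℝ :=
  ∑ ξ, w ξ * NormedSpace.exp (t • LinearMap.toContinuousLinearMap (generator n ρ))
    (Pi.single η 1) ξ

section EvolvedWeight

variable (n : ℕ) (ρ : ℝ) (w : Config n → ℝ)

theorem sum_evolvedWeight_mul (t : ℝ) (f : Config n → ℝ) :
    ∑ η, evolvedWeight n ρ w t η * f η =
      ∑ ξ, w ξ * NormedSpace.exp (t • LinearMap.toContinuousLinearMap (generator n ρ)) f ξ := by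
  have hf : f = ∑ η, f η • (Pi.single η (1 : ℝ) : Config n → ℝ) := by
    funext ξ
    simp [Finset.sum_apply, Pi.single_apply]
  conv_rhs => rw [hf]
  simp only [evolvedWeight, map_sum, map_smul, Finset.sum_apply, Pi.smul_apply, smul_eq_mul,
    Finset.mul_sum, Finset.sum_mul]
  rw [Finset.sum_comm]
  exact Finset.sum_congr rfl fun ξ _ => Finset.sum_congr rfl fun η _ => by ring

theorem evolvedWeight_zero : evolvedWeight n ρ w 0 = w := by
  funext ξ
  simp [evolvedWeight, Pi.single_apply]

theorem hasDerivAt_sum_evolvedWeight_mul (f : Config n → ℝ) (t : ℝ) :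
    HasDerivAt (fun s => ∑ η, evolvedWeight n ρ w s η * f η)
      (∑ η, evolvedWeight n ρ w t η * generator n ρ f η) t := by
  simp only [sum_evolvedWeight_mul]
  refine HasDerivAt.fun_sum fun ξ _ => HasDerivAt.const_mul _ ?_
  have hexp := (hasDerivAt_exp_smul_const (𝕂 := ℝ)
    (LinearMap.toContinuousLinearMap (generator n ρ)) t).clm_apply (hasDerivAt_const t f)
  simpa using hasDerivAt_pi.1 hexp ξ

theorem sum_evolvedWeight (t : ℝ) : ∑ η, evolvedWeight n ρ w t η = ∑ η, w η := by
  have hderiv : ∀ s, HasDerivAt (fun s => ∑ η, evolvedWeight n ρ w s η) 0 s := fun s => by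
    simpa [generator_const] using hasDerivAt_sum_evolvedWeight_mul n ρ w (fun _ => 1) s
  rw [is_const_of_deriv_eq_zero (fun s => (hderiv s).differentiableAt)
    (fun s => (hderiv s).deriv) t 0, evolvedWeight_zero]

end EvolvedWeight

/-- Under `P`, each `η t` has the law at time `t` of the chain generated by `generator n ρ` and
started from `ν`. Nothing is assumed on the joint laws of `η`. -/
structure HasMarginals {n : ℕ} {Ω : Type*} [MeasurableSpace Ω] (ρ : ℝ) (ν : Measure (Config n))
    (P : Measure Ω) (η : ℝ≥0 → Ω → Config n) : Prop where
  measurable : ∀ t, Measurable (η t)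
  integral_comp : ∀ (t : ℝ≥0) (f : Config n → ℝ),
    ∫ ω, f (η t ω) ∂P = ∫ ξ, semigroup n ρ t f ξ ∂ν

theorem IsProcess.hasMarginals {n : ℕ} {Ω : Type*} [MeasurableSpace Ω] {ρ : ℝ}
    {ν : Measure (Config n)} {P : Measure Ω} [IsFiniteMeasure P] {η : ℝ≥0 → Ω → Config n}
    (h : IsProcess ρ ν P η) : HasMarginals ρ ν P η := by
  refine ⟨h.measurable, fun t f => ?_⟩
  have hpast : past η 0 ≤ ‹MeasurableSpace Ω› := iSup₂_le fun r _ => (h.measurable r).comap_le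
  have hmarkov := h.markov 0 t f
  rw [zero_add] at hmarkov
  rw [← integral_condExp hpast, integral_congr_ae hmarkov, ← h.initial,
    integral_map (h.measurable 0).aemeasurable (measurable_of_finite _).aestronglyMeasurable]

namespace HasMarginals

variable {n : ℕ} {Ω : Type*} [MeasurableSpace Ω] {ρ : ℝ} {u : Site n → ℝ} {P : Measure Ω}
  {η : ℝ≥0 → Ω → Config n}

theorem integral_comp_eq_sum (h : HasMarginals ρ (bernoulliProduct u) P η)
    (hu : ∀ η, 0 ≤ weight u η) (t : ℝ≥0) (f : Config n → ℝ) :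
    ∫ ω, f (η t ω) ∂P = ∑ ξ, evolvedWeight n ρ (weight u) t ξ * f ξ := by
  rw [h.integral_comp, integral_bernoulliProduct hu, sum_evolvedWeight_mul]
  rfl

theorem map_real_singleton (h : HasMarginals ρ (bernoulliProduct u) P η)
    (hu : ∀ η, 0 ≤ weight u η) (t : ℝ≥0) (ξ : Config n) :
    (P.map (η t)).real {ξ} = evolvedWeight n ρ (weight u) t ξ := by
  have hsingle := h.integral_comp_eq_sum hu t (({ξ} : Set (Config n)).indicator 1)
  have hind : (fun ω => ({ξ} : Set (Config n)).indicator (1 : Config n → ℝ) (η t ω)) =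
      (η t ⁻¹' {ξ}).indicator 1 := rfl
  rw [hind, integral_indicator_one (h.measurable t (measurableSet_singleton ξ))] at hsingle
  rw [map_measureReal_apply (h.measurable t) (measurableSet_singleton ξ), hsingle]
  simp [Set.indicator_apply]

theorem map_singleton [IsFiniteMeasure P] (h : HasMarginals ρ (bernoulliProduct u) P η)
    (hu : ∀ η, 0 ≤ weight u η) (t : ℝ≥0) (ξ : Config n) :
    P.map (η t) {ξ} = ENNReal.ofReal (evolvedWeight n ρ (weight u) t ξ) := by
  rw [← h.map_real_singleton hu, ofReal_measureReal]

theorem isForwardSolution (h : HasMarginals ρ (bernoulliProduct u) P η)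
    (hu : ∀ η, 0 ≤ weight u η) : IsForwardSolution n ρ (evolvedWeight n ρ (weight u)) where
  hasDerivAt := hasDerivAt_sum_evolvedWeight_mul n ρ (weight u)
  nonneg t ht ξ := h.map_real_singleton hu ⟨t, ht⟩ ξ ▸ measureReal_nonneg
  sum_eq_one t := (sum_evolvedWeight n ρ (weight u) t).trans (sum_weight_eq_one u)

theorem density_eq_profile (h : HasMarginals ρ (bernoulliProduct u) P η)
    (hu : ∀ η, 0 ≤ weight u η) (t : ℝ≥0) :
    density ρ P η t = profile ρ (evolvedWeight n ρ (weight u)) t := by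
  funext k
  by_cases hk : k ∈ Finset.Ioo 0 n
  · simp only [density, hk, dif_pos, profile, extOcc]
    exact h.integral_comp_eq_sum hu t fun ξ => occ (ξ ⟨k, hk⟩)
  · rw [(h.isForwardSolution hu).profile_of_notMem _ hk, density, dif_neg hk]

end HasMarginals

namespace IsForwardSolution

theorem isHeatSolution {n : ℕ} {ρ : ℝ} {p : ℝ → Config n → ℝ} {u₀ : ℝ → ℝ}
    (hp : IsForwardSolution n ρ p) (hn : 3 ≤ n)
    (h0 : p 0 = weight fun x : Site n => u₀ ((x.1 : ℝ) / n)) :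
    IsHeatSolution n ρ u₀ fun t => profile ρ p t where
  equation t x hx := by
    refine (hp.hasDerivAt_profile hn t hx).hasDerivWithinAt.congr (fun s hs => ?_) ?_
    · rw [Real.coe_toNNReal s hs]
    · rw [Real.toNNReal_coe]
  left t := hp.profile_of_notMem _ (by simp)
  right t := hp.profile_of_notMem _ (by simp)
  initial x hx := profile_of_eq_weight h0 ⟨x, hx⟩

theorem eq_weight_profile_of_two {ρ : ℝ} {p : ℝ → Config 2 → ℝ} (hp : IsForwardSolution 2 ρ p)
    (t : ℝ) : p t = weight fun x : Site 2 => profile ρ p t x.1 := by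
  have : Unique (Site 2) := ⟨⟨1, by simp⟩, fun x => Subtype.ext (by
    have := Finset.mem_Ioo.1 x.2
    change x.1 = 1
    omega)⟩
  have hsum : ∀ f : Config 2 → ℝ, ∑ η, f η = f (fun _ => true) + f fun _ => false := fun f => by
    rw [← (Equiv.funUnique (Site 2) Bool).symm.sum_comp, Fintype.sum_bool]
    rfl
  have hprofile : ∀ x : Site 2, profile ρ p t x.1 = p t fun _ => true := fun x => by
    simp only [profile, extOcc_site, hsum, occ, if_true, Bool.false_eq_true, if_false, mul_one,
      mul_zero, add_zero]
  have hmass : (p t fun _ => true) + (p t fun _ => false) = 1 :=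
    (hsum _).symm.trans (hp.sum_eq_one t)
  funext ξ
  obtain ⟨b, rfl⟩ : ∃ b, ξ = fun _ => b :=
    ⟨ξ default, funext fun x => congrArg ξ (Subsingleton.elim x default)⟩
  simp only [weight, hprofile, Fintype.prod_unique, siteWeight]
  cases b
  · simp only [occ, Bool.false_eq_true, if_false]
    linarith
  · simp only [occ, if_true]
    ring

end IsForwardSolution

namespace HasMarginals

variable {n : ℕ} {Ω : Type*} [MeasurableSpace Ω] {ρ ε : ℝ} {κ : ℝ≥0} {u₀ : ℝ → ℝ}
  {P : Measure Ω} [IsProbabilityMeasure P] {η : ℝ≥0 → Ω → Config n}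

theorem klDiv_eq_zero_of_two {u : Site 2 → ℝ} {η : ℝ≥0 → Ω → Config 2}
    (h : HasMarginals ρ (bernoulliProduct u) P η) (hu : ∀ η, 0 ≤ weight u η) (t : ℝ≥0) :
    InformationTheory.klDiv (P.map (η t))
      (bernoulliProduct fun x : Site 2 => density ρ P η t x.1) = 0 := by
  have := Measure.isProbabilityMeasure_map (μ := P) (h.measurable t).aemeasurable
  have hlaw : P.map (η t) = bernoulliProduct fun x : Site 2 => density ρ P η t x.1 := by
    refine Measure.ext_of_singleton fun ξ => ?_
    rw [h.density_eq_profile hu, bernoulliProduct_singleton,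
      ← (h.isForwardSolution hu).eq_weight_profile_of_two, h.map_singleton hu]
  rw [← hlaw, InformationTheory.klDiv_self]

theorem klDiv_le (h : HasMarginals ρ (bernoulliProduct fun x : Site n => u₀ ((x.1 : ℝ) / n)) P η)
    (hn : 3 ≤ n) (hε : 0 < ε) (hu₀ : IsLipschitzProfile ρ ε κ u₀) (t : ℝ≥0) :
    InformationTheory.klDiv (P.map (η t))
        (bernoulliProduct fun x : Site n => density ρ P η t x.1) ≤
      ENNReal.ofReal (2 * (4 * κ) ^ 4 / ε ^ 4 *
        Real.exp (-(1 / sobolevConst ε (4 * κ)) * t)) := by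
  have := Measure.isProbabilityMeasure_map (μ := P) (h.measurable t).aemeasurable
  have hu := fun ξ => (hu₀.weight_pos hε n ξ).le
  have hp := h.isForwardSolution hu
  have h0 := evolvedWeight_zero n ρ (weight fun x : Site n => u₀ ((x.1 : ℝ) / n))
  have hprofile := hp.profile_mem_Icc_of_isLipschitzProfile hn hu₀ h0 t.2
  have hentropy := klDiv_bernoulliProduct (h.map_singleton hu t) (hp.nonneg t t.2)
    (weight_pos fun x : Site n => siteWeight_pos hε (hprofile x.1))
  rw [h.density_eq_profile hu]
  exact hentropy.trans_le (ENNReal.ofReal_le_ofReal (hp.entropy_le hn hε hu₀ h0 t.2))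

end HasMarginals

end SSEP

end

theorem theorem2_general (ε₀ : ℝ) (κ : ℝ≥0) (hε₀ : 0 < ε₀) :
    ∃ C₀ δ₀ : ℝ, 0 < C₀ ∧ 0 < δ₀ ∧
      ∀ (ρ : ℝ) (u₀ : ℝ → ℝ), SSEP.IsLipschitzProfile ρ ε₀ κ u₀ →
      ∀ (n : ℕ), 2 ≤ n →
      ∀ (Ω : Type*) [MeasurableSpace Ω] (P : Measure Ω) [IsProbabilityMeasure P]
        (η : ℝ≥0 → Ω → SSEP.Config n),
        SSEP.HasMarginals ρ (SSEP.bernoulliProduct fun x : SSEP.Site n => u₀ ((x.1 : ℝ) / n)) P η →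
        (3 ≤ n → SSEP.IsHeatSolution n ρ u₀ (SSEP.density ρ P η)) ∧
        ∀ t : ℝ≥0,
          InformationTheory.klDiv (P.map (η t))
              (SSEP.bernoulliProduct fun x : SSEP.Site n => SSEP.density ρ P η t x.1)
            ≤ ENNReal.ofReal (C₀ * Real.exp (-δ₀ * t)) := by
  refine ⟨2 * (4 * κ) ^ 4 / ε₀ ^ 4 + 1, 1 / SSEP.sobolevConst ε₀ (4 * κ), by positivity,
    one_div_pos.2 (one_pos.trans_le (SSEP.one_le_sobolevConst hε₀)), ?_⟩
  intro ρ u₀ hu₀ n hn Ω _ P _ η hη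
  have hweight := fun ξ => (hu₀.weight_pos hε₀ n ξ).le
  refine ⟨fun hn3 => ?_, fun t => ?_⟩
  · rw [funext (hη.density_eq_profile hweight)]
    exact (hη.isForwardSolution hweight).isHeatSolution hn3 (SSEP.evolvedWeight_zero n ρ _)
  · obtain rfl | hn3 := hn.eq_or_lt
    · rw [hη.klDiv_eq_zero_of_two hweight t]
      exact zero_le
    · exact (hη.klDiv_le hn3 hε₀ hu₀ t).trans (ENNReal.ofReal_le_ofReal
        (mul_le_mul_of_nonneg_right (le_add_of_nonneg_right zero_le_one) (Real.exp_pos _).le))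

theorem theorem2 (ε₀ κ : ℝ) (hε₀ : 0 < ε₀) (hκ : 0 ≤ κ) :
    ∃ C₀ δ₀ : ℝ, 0 < C₀ ∧ 0 < δ₀ ∧
      ∀ (ρ : ℝ), ε₀ ≤ min ρ (1 - ρ) →
      ∀ (u₀ : ℝ → ℝ), SSEP.IsProfile ρ ε₀ κ u₀ →
      ∀ (n : ℕ), 2 ≤ n →
      ∀ (Ω : Type*) [MeasurableSpace Ω] (P : Measure Ω) [IsProbabilityMeasure P]
        (η : ℝ≥0 → Ω → SSEP.Config n),
        SSEP.IsProcess ρ (SSEP.bernoulliProduct fun x : SSEP.Site n => u₀ ((x.1 : ℝ) / n)) P η →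
        (3 ≤ n → SSEP.IsHeatSolution n ρ u₀ (SSEP.density ρ P η)) ∧
        ∀ t : ℝ≥0,
          InformationTheory.klDiv (P.map (η t))
              (SSEP.bernoulliProduct fun x : SSEP.Site n => SSEP.density ρ P η t x.1)
            ≤ ENNReal.ofReal (C₀ * Real.exp (-δ₀ * t)) := by
  obtain ⟨C₀, δ₀, hC₀, hδ₀, h⟩ := theorem2_general ε₀ ⟨κ, hκ⟩ hε₀
  exact ⟨C₀, δ₀, hC₀, hδ₀, fun ρ _ u₀ hu₀ n hn Ω _ P _ η hη =>
    h ρ u₀ (hu₀.isLipschitzProfile (κ := ⟨κ, hκ⟩)) n hn Ω P η hη.hasMarginals⟩
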